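/- Theorem (exactly solvable quantum toboggan). Let $D$ and $n$ be integers, let $N\ge 1$ be an integer (the winding number), and let $M\ge 1$ be an integer with $M\notin\{2N,4N,6N,\dots\}$. Put $$\ell=n+\frac{D-3}{2},\qquad \gamma=\Big(\frac{M}{2N}\Big)^2-\Big(n+\frac{D-2}{2}\Big)^2,\qquad \nu=\frac{M}{2N}\notin\mathbb Z .$$ Let $\mathcal R$ be the Riemann surface of $\log r$ (so $\arg r\in\mathbb R$ is not reduced modulo $2\pi$), and for $k\in\mathbb Z$ let $\mathcal S_k=\{r\in\mathcal R: (k-1)\pi<\arg r<k\pi\}$ (the $k$-th Stokes wedge). For every $\kappa>0$ the function $$\psi(r)=\sqrt r\,H^{(2)}_\nu(\kappa\, r\,e^{iN\pi}),\qquad r\in\mathcal R,$$ is analytic on $\mathcal R$, satisfies $$-\psi''(r)+\frac{\ell(\ell+1)}{r^2}\,\psi(r)+\frac{\gamma}{r^2}\,\psi(r)=E\,\psi(r),\qquad E=\kappa^2,$$ on $\mathcal R$, and is a bound state, that is, its restriction to $\mathcal C$ is a nonzero element of $L^2(\mathcal C,|dr|)$, for each of the following contours $\mathcal C$: (a) every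 tobogganic contour of winding number $N$, i.e. every $C^1$ curve $s\mapsto r(s)\in\mathcal R$, $s\in\mathbb R$, such that (i) $\mathcal C$ is left-right symmetric: $|r(-s)|=|r(s)|$ and $\arg r(-s)=-\pi-\arg r(s)$; (ii) $r(s)=-i\varepsilon+vs+O(s^2)$ as $s\to0$ for some $\varepsilon,v>0$ (with $\arg r(0)=-\pi/2$); (iii) $\mathcal C$ is asymptotically linear with ends in the wedges $\mathcal S_{\pm N}$: as $s\to+\infty$ one has $|r(s)|\to\infty$, $\arg r(s)\to\theta$ and $r'(s)/|r'(s)|\to e^{i\theta}$ for some $\theta\in((N-1)\pi,N\pi)$. (For $\theta=N\pi-\pi/2$ the contour encircles the origin by the total angle $2\alpha$ with $\alpha=N\pi$.) (b) every spiral $r(s)=-i\,[\,i(s-i\varepsilon)]^{2N+1}$, $s\in\mathbb R$, with $\varepsilon>0$, where $\arg r(s)=-\pi/2+(2N+1)\arg(\varepsilon+is)$. Here $H^{(2)}_\nu(z)=\dfrac{J_{-\nu}(z)-e^{i\pi\nu}J_\nu(z)}{-i\sin\pi\nu}$ is the Hankel function of non-integer order on the Riemann surface of the logarithm, with $J_\nu(z)=\sum_{k\ge0}\frac{(-1)^k}{k!\,\Gamma(k+\nu+1)}(z/2)^{2k+\nu}$.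 -/

import Mathlib

/-! The Riemann surface of the logarithm (the universal cover of `ℂ \ {0}`) is described by its
global logarithmic coordinate `w : ℂ`: the point with coordinate `w` lies above `r = exp w`, it
has modulus `exp w.re` and (unreduced) argument `w.im`.  Functions of the multivalued variable `r`
are functions `ψ : ℂ → ℂ` of `w`, and curves on the surface are maps `c : ℝ → ℂ`. -/

namespace Toboggan

open Filter Topology MeasureTheory

noncomputable section

/-- The derivative `d/dr = (dr/dw)⁻¹ d/dw`, with `r = exp w`, of a function on the surface. -/
def rDeriv (ψ : ℂ → ℂ) (w : ℂ) : ℂ := deriv ψ w / Complex.exp w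

/-- `ψ` is a solution, analytic on the whole Riemann surface of the logarithm, of
`-ψ'' + (ℓ(ℓ+1)/r²) ψ + (γ/r²) ψ = E ψ`. -/
def SolvesSchrodinger (ℓ γ E : ℝ) (ψ : ℂ → ℂ) : Prop :=
  Differentiable ℂ ψ ∧ ∀ w : ℂ,
    -rDeriv (rDeriv ψ) w + ((ℓ * (ℓ + 1) : ℝ) : ℂ) / Complex.exp w ^ 2 * ψ w
      + (γ : ℂ) / Complex.exp w ^ 2 * ψ w = (E : ℂ) * ψ w

/-- The projection `s ↦ r(s)` to the punctured plane of a curve on the surface. -/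
def proj (c : ℝ → ℂ) (s : ℝ) : ℂ := Complex.exp (c s)

/-- The arc length measure `|dr|` along a curve, as a measure on the parameter line. -/
def arcLength (c : ℝ → ℂ) : Measure ℝ := volume.withDensity fun s => ‖deriv (proj c) s‖ₑ

/-- `ψ` is a bound state of energy `E` on the contour `c`: an analytic solution of the equation
whose restriction to the contour is a nonzero element of `L²` with respect to arc length. -/
def IsBoundState (c : ℝ → ℂ) (ℓ γ E : ℝ) (ψ : ℂ → ℂ) : Prop :=
  SolvesSchrodinger ℓ γ E ψ ∧
  MemLp (fun s => ψ (c s)) 2 (arcLength c) ∧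
  ¬ ((fun s => ψ (c s)) =ᵐ[arcLength c] 0)

/-- The arguments of the points of the open Stokes wedge
`S_k = {r = -i e^{ikπ} ρ e^{iφ} | ρ > 0, -π/2 < φ < π/2}`. -/
def stokesArgs (k : ℤ) : Set ℝ := Set.Ioo (k * Real.pi - Real.pi) (k * Real.pi)

/-- Tobogganic contours of winding number `N`: curves on the Riemann surface of the logarithm
which are left-right symmetric, cross the negative imaginary axis of the zeroth sheet in the
direction of the real axis, and are asymptotically linear, their right end (hence, by symmetry, the
left one) running to infinity along a direction in the Stokes wedge `S_N` (resp. `S_{-N}`).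
The direction `-π/2 + Nπ` on the axis of `S_N` gives the total angle `2πN`. -/
structure IsTobogganicContour (N : ℕ) (c : ℝ → ℂ) : Prop where
  contDiff : ContDiff ℝ 1 c
  /-- The reflection `r ↦ -conj r` of the surface that fixes the ray of argument `-π/2`. -/
  symm : ∀ s, c (-s) = (starRingEnd ℂ) (c s) - Real.pi * Complex.I
  /-- `r(s) = -iε + v s + O(s²)` as `s → 0`, with `ε, v > 0`. -/
  start : ∃ ε > (0 : ℝ), ∃ v > (0 : ℝ),
    (fun s : ℝ => proj c s - (-Complex.I * ε + v * s)) =O[𝓝 0] fun s : ℝ => s ^ 2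
  /-- `|r| → ∞`, while both `arg r` and the direction of the tangent tend to an angle `θ`. -/
  ends : ∃ θ ∈ stokesArgs N,
    Tendsto (fun s => (c s).re) atTop atTop ∧
    Tendsto (fun s => (c s).im) atTop (𝓝 θ) ∧
    Tendsto (fun s => deriv (proj c) s / (‖deriv (proj c) s‖ : ℂ)) atTop
      (𝓝 (Complex.exp (θ * Complex.I)))

/-- The lift to the surface of the curve `r(s) = -i [i (s - iε)]^(2N+1)`; here
`i (s - iε) = ε + i s` has positive real part and its principal logarithm is used. -/
def spiral (N : ℕ) (ε : ℝ) (s : ℝ) : ℂ :=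
  -(Real.pi / 2) * Complex.I + (2 * N + 1) * Complex.log (Complex.I * (s - Complex.I * ε))

/-- The Bessel function `J_ν(z) = ∑ₖ (-1)^k / (k! Γ(k+ν+1)) (z/2)^(2k+ν)` on the Riemann surface of
the logarithm, `z = exp w`. -/
def besselJ (ν w : ℂ) : ℂ :=
  ∑' k : ℕ, (-1 : ℂ) ^ k / ((k.factorial : ℂ) * Complex.Gamma (k + ν + 1)) *
    Complex.exp ((2 * k + ν) * (w - Real.log 2))

/-- The Hankel function `H^(2)_ν(z)`, for an order `ν` that is not an integer, on the Riemann
surface of the logarithm, `z = exp w`. -/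
def hankel2 (ν w : ℂ) : ℂ :=
  (besselJ (-ν) w - Complex.exp (Complex.I * Real.pi * ν) * besselJ ν w) /
    (-Complex.I * Complex.sin (Real.pi * ν))

/-- The wave function `√r H^(2)_ν(κ e^{iNπ} r)`, with `r = exp w`. -/
def waveFunction (N : ℕ) (ν κ : ℝ) (w : ℂ) : ℂ :=
  Complex.exp (w / 2) * hankel2 ν (Real.log κ + N * Real.pi * Complex.I + w)

end

end Toboggan

/-!
In the logarithmic coordinate `w`, `z = exp w`, Bessel's equation reads `y'' = (ν² - e^{2w}) y`, and
`√r y(κ r e^{iNπ})` solves the radial equation because `ℓ(ℓ+1) + γ = ν² - 1/4`.  Continuation of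
`z` through `2N` half-turns around the origin multiplies `J_ν` and `J_{-ν}` by
`e^{± 2πiNν} = (-1)^M`; hence `H^(2)_ν` is the same function, up to sign, on the sheets
`-π ≤ arg z ≤ 0` and `(2N-1)π ≤ arg z ≤ 2Nπ`, to which the two ends of the contours are mapped.
Square integrability thus reduces to the estimate
`|√z H^(2)_ν(z)| ≤ C e^{Im z}` for `-π ≤ arg z ≤ 0` and `|z| ≥ 1`
(`exists_norm_sqrt_mul_hankel2_le`).  It has to hold up to the boundary of the sheet, since the
spirals are asymptotic to the edges of the Stokes wedges.

The estimate is proved in three steps.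
* On the ray `arg z = -π/2` the Hankel function is a multiple of `I_{-ν} - I_ν`.  Laplace's method
  for a Poisson integral and downward recurrence in the order give `I_μ(x) ∼ e^x / √(2πx)` for
  every real `μ` (`tendsto_besselI`), so that `H / J_ν` tends to `0`; its derivative is a constant
  Wronskian over `J_ν²`, and integrating it from infinity shows that `H` decays like `e^{-x} / √x`
  (`exists_norm_hankel2_le_on_ray`).
* On the rays `arg z = 0` and `arg z = -π` the equation `U'' = -(1 - (ν² - 1/4)/x²) U` conserves
  the energy `|U|² + |U'|²` up to a bounded factor, so that `U = √z H` is bounded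
  (`IsBesselSolution.exists_norm_le_of_im_eq`).
* The Phragmén–Lindelöf principle for `e^{iz} √z H(z)` in the lower half-plane extends the bounds
  from these rays to the closed half-plane.

The contours are symmetric, so only their right ends need to be examined: an asymptotically linear
end stays in a compact subsector of the wedge, where the wave function decays exponentially in
`|r|`, and along a spiral with `|r| = ρ^{2N+1}` it is `O(exp (-κ ε ρ^{2N}))`.  The wave
function is not zero on a contour because it is analytic and because a half-turn
multiplies `J_ν` and `J_{-ν}` by different factors `e^{± iπν}` when `ν` is not an integer.
-/

namespace Toboggan

open Filter Topology MeasureTheory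

/-! ### The entire function behind the Bessel series -/

/-- The coefficients `1 / (k! Γ(k+ν+1))` of the Bessel series of real order `ν`.  As `Real.Gamma`
is `0` at the poles of `Γ`, they vanish there, in accordance with `1/Γ` being entire. -/
noncomputable def besselCoeff (ν : ℝ) (k : ℕ) : ℝ := 1 / (k.factorial * Real.Gamma (k + ν + 1))

/-- The entire function `Φ_ν(q) = ∑ₖ q^k / (k! Γ(k+ν+1))`, for which
`J_ν(z) = (z/2)^ν Φ_ν(-z²/4)` and `I_ν(z) = (z/2)^ν Φ_ν(z²/4)`. -/
noncomputable def besselPhi (ν : ℝ) (q : ℂ) : ℂ := ∑' k : ℕ, (besselCoeff ν k : ℂ) * q ^ k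

lemma besselCoeff_succ (ν : ℝ) (k : ℕ) :
    (k + 1) * besselCoeff ν (k + 1) = besselCoeff (ν + 1) k := by
  have hk : (k : ℝ) + 1 ≠ 0 := by positivity
  have hf : (k.factorial : ℝ) ≠ 0 := by positivity
  unfold besselCoeff
  rw [Nat.factorial_succ, show ((k + 1 : ℕ) : ℝ) + ν + 1 = k + (ν + 1) + 1 by push_cast; ring]
  push_cast
  rw [mul_assoc, one_div, one_div, mul_inv, ← mul_assoc, mul_inv_cancel₀ hk, one_mul]

lemma besselCoeff_eq_mul (ν : ℝ) (k : ℕ) :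
    besselCoeff ν k = (k + ν + 1) * besselCoeff (ν + 1) k := by
  unfold besselCoeff
  rw [show (k : ℝ) + (ν + 1) + 1 = (k + ν + 1) + 1 by ring]
  rcases eq_or_ne ((k : ℝ) + ν + 1) 0 with h | h
  · simp [h]
  · rw [Real.Gamma_add_one h]
    field_simp

/-- The coefficients are dominated by those of `cosh √(A q)`; this gives both the convergence of
the series and the growth of its sum. -/
lemma exists_abs_besselCoeff_le (ν : ℝ) :
    ∃ C > 0, ∃ A > 0, ∀ k : ℕ, |besselCoeff ν k| ≤ C * A ^ k / (2 * k).factorial := by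
  obtain ⟨m, hm⟩ := exists_nat_ge (1 - ν)
  replace hm : 1 - (m : ℝ) ≤ ν := by linarith
  induction m generalizing ν with
  | zero =>
    simp only [CharP.cast_eq_zero, sub_zero] at hm
    refine ⟨1, one_pos, 4, by norm_num, fun k => ?_⟩
    have h1 : (k.factorial : ℝ) ≤ Real.Gamma (k + ν + 1) := by
      calc (k.factorial : ℝ) ≤ ((k + 1).factorial : ℝ) := by
            exact_mod_cast Nat.factorial_le (Nat.le_succ k)
        _ = Real.Gamma ((k + 1 : ℕ) + 1) := (Real.Gamma_nat_eq_factorial _).symm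
        _ ≤ _ := by
          apply Real.Gamma_strictMonoOn_Ici.monotoneOn
          · simp only [Set.mem_Ici]; push_cast; linarith [(k.cast_nonneg : (0:ℝ) ≤ k)]
          · simp only [Set.mem_Ici]; linarith [(k.cast_nonneg : (0:ℝ) ≤ k)]
          · push_cast; linarith
    have hk : (0 : ℝ) < k.factorial := by positivity
    have h2 : ((2 * k).factorial : ℝ) ≤ 4 ^ k * (k.factorial * k.factorial) := by
      have := Nat.centralBinom_le_four_pow k
      have h3 := Nat.choose_mul_factorial_mul_factorial (show k ≤ 2 * k by omega)
      rw [← Nat.centralBinom_eq_two_mul_choose, show 2 * k - k = k by omega] at h3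
      have h4 : (2 * k).factorial ≤ 4 ^ k * (k.factorial * k.factorial) := by
        rw [← h3, mul_assoc]; gcongr
      exact_mod_cast h4
    have hG : 0 < Real.Gamma (k + ν + 1) := hk.trans_le h1
    unfold besselCoeff
    rw [abs_of_nonneg (by positivity), one_mul, div_le_div_iff₀ (by positivity) (by positivity),
      one_mul]
    exact h2.trans (by gcongr)
  | succ m ih =>
    obtain ⟨C, hC, A, hA, h⟩ := ih (ν + 1) (by push_cast at hm; linarith)
    refine ⟨C * (1 + |ν + 1|), by positivity, 2 * A, by positivity, fun k => ?_⟩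
    have hk : |(k : ℝ) + ν + 1| ≤ (1 + |ν + 1|) * 2 ^ k := by
      have h1 : (k : ℝ) ≤ 2 ^ k := by exact_mod_cast Nat.lt_two_pow_self.le
      have h2 : (1 : ℝ) ≤ 2 ^ k := one_le_pow₀ (by norm_num)
      calc |(k : ℝ) + ν + 1| = |(k : ℝ) + (ν + 1)| := by ring_nf
        _ ≤ |(k : ℝ)| + |ν + 1| := abs_add_le _ _
        _ = k + |ν + 1| := by rw [Nat.abs_cast]
        _ ≤ 2 ^ k + |ν + 1| * 2 ^ k := by nlinarith [abs_nonneg (ν + 1)]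
        _ = _ := by ring
    rw [besselCoeff_eq_mul, abs_mul]
    calc |(k : ℝ) + ν + 1| * |besselCoeff (ν + 1) k|
        ≤ ((1 + |ν + 1|) * 2 ^ k) * (C * A ^ k / (2 * k).factorial) := by gcongr; exact h k
      _ = _ := by rw [mul_pow]; ring

lemma exists_summable_bound (ν : ℝ) :
    ∃ C > 0, ∃ A > 0, ∀ R : ℝ, 0 ≤ R →
      HasSum (fun k : ℕ => C * A ^ k / (2 * k).factorial * R ^ k) (C * Real.cosh √(A * R)) ∧
      ∀ q : ℂ, ‖q‖ ≤ R → ∀ k : ℕ,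
        ‖(besselCoeff ν k : ℂ) * q ^ k‖ ≤ C * A ^ k / (2 * k).factorial * R ^ k := by
  obtain ⟨C, hC, A, hA, h⟩ := exists_abs_besselCoeff_le ν
  refine ⟨C, hC, A, hA, fun R hR => ⟨?_, fun q hq k => ?_⟩⟩
  · have := (Real.hasSum_cosh √(A * R)).mul_left C
    refine (congrArg (HasSum · _) (funext fun k => ?_)).mpr this
    rw [pow_mul, Real.sq_sqrt (by positivity), mul_pow]
    ring
  · rw [norm_mul, norm_pow, Complex.norm_real, Real.norm_eq_abs]
    gcongr
    exact h k

lemma summable_besselPhi (ν : ℝ) (q : ℂ) :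
    Summable fun k : ℕ => (besselCoeff ν k : ℂ) * q ^ k := by
  obtain ⟨C, -, A, -, h⟩ := exists_summable_bound ν
  exact .of_norm_bounded (h ‖q‖ (norm_nonneg _)).1.summable ((h ‖q‖ (norm_nonneg _)).2 q le_rfl)

lemma exists_norm_besselPhi_le (ν : ℝ) :
    ∃ C > 0, ∃ A > 0, ∀ q : ℂ, ‖besselPhi ν q‖ ≤ C * Real.exp √(A * ‖q‖) := by
  obtain ⟨C, hC, A, hA, h⟩ := exists_summable_bound ν
  refine ⟨C, hC, A, hA, fun q => ?_⟩
  obtain ⟨h1, h2⟩ := h ‖q‖ (norm_nonneg _)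
  refine (tsum_of_norm_bounded h1 (h2 q le_rfl)).trans ?_
  gcongr
  have hx := Real.sqrt_nonneg (A * ‖q‖)
  have := Real.exp_le_exp.mpr (show -√(A * ‖q‖) ≤ √(A * ‖q‖) by linarith)
  rw [Real.cosh_eq]
  linarith

lemma hasDerivAt_besselPhi (ν : ℝ) (q : ℂ) :
    HasDerivAt (besselPhi ν) (besselPhi (ν + 1) q) q := by
  obtain ⟨C, -, A, -, h⟩ := exists_summable_bound ν
  obtain ⟨h1, h2⟩ := h (‖q‖ + 1) (by positivity)
  have hU : IsOpen (Metric.ball (0 : ℂ) (‖q‖ + 1)) := Metric.isOpen_ball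
  have hq : q ∈ Metric.ball (0 : ℂ) (‖q‖ + 1) := by simp
  have hb : ∀ (k : ℕ) (w : ℂ), w ∈ Metric.ball (0 : ℂ) (‖q‖ + 1) →
      ‖(besselCoeff ν k : ℂ) * w ^ k‖ ≤ C * A ^ k / (2 * k).factorial * (‖q‖ + 1) ^ k :=
    fun k w hw => h2 w (by simpa using (mem_ball_zero_iff.mp hw).le) k
  have hd : ∀ k : ℕ, DifferentiableOn ℂ (fun w : ℂ => (besselCoeff ν k : ℂ) * w ^ k)
      (Metric.ball (0 : ℂ) (‖q‖ + 1)) := fun k => by fun_prop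
  have hs := Complex.hasSum_deriv_of_summable_norm h1.summable hd hU hb hq
  have hD := ((Complex.differentiableOn_tsum_of_summable_norm h1.summable hd hU hb).differentiableAt
    (hU.mem_nhds hq)).hasDerivAt
  have h0 : deriv (fun w : ℂ => ∑' k : ℕ, (besselCoeff ν k : ℂ) * w ^ k) q
      = besselPhi (ν + 1) q := by
    rw [← hs.tsum_eq, hs.summable.tsum_eq_zero_add]
    simp only [pow_zero, mul_one, deriv_const, zero_add, besselPhi]
    refine tsum_congr fun k => ?_
    have := congrArg (fun x : ℝ => (x : ℂ)) (besselCoeff_succ ν k)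
    push_cast at this
    rw [← this]
    simp
    ring
  rw [h0] at hD
  exact hD

/-- The contiguous relation, which is both the differential equation of `Φ_ν` and the three-term
recurrence of the modified Bessel functions. -/
lemma besselPhi_contiguous (ν : ℝ) (q : ℂ) :
    besselPhi ν q = q * besselPhi (ν + 2) q + (ν + 1) * besselPhi (ν + 1) q := by
  have h1 : HasSum (fun k : ℕ => (k : ℂ) * ((besselCoeff (ν + 1) k : ℂ) * q ^ k))
      (q * besselPhi (ν + 2) q) := by
    rw [← hasSum_nat_add_iff' 1]
    have := ((summable_besselPhi (ν + 2) q).hasSum).mul_left q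
    simp only [Finset.range_one, Finset.sum_singleton, CharP.cast_eq_zero, zero_mul, sub_zero]
    refine (congrArg (HasSum · _) (funext fun k => ?_)).mpr this
    have := congrArg (fun x : ℝ => (x : ℂ)) (besselCoeff_succ (ν + 1) k)
    rw [show ν + 1 + 1 = ν + 2 by ring] at this
    push_cast at this ⊢
    rw [← this]
    ring
  have h2 := h1.add (((summable_besselPhi (ν + 1) q).hasSum).mul_left (ν + 1 : ℂ))
  refine HasSum.tsum_eq ?_
  refine (congrArg (HasSum · _) (funext fun k => ?_)).mpr h2
  rw [besselCoeff_eq_mul]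
  push_cast
  ring

/-! ### The Bessel functions on the Riemann surface of the logarithm -/

lemma besselJ_eq (ν : ℝ) (w : ℂ) :
    besselJ ν w = Complex.exp (ν * (w - Real.log 2)) *
      besselPhi ν (-Complex.exp (2 * (w - Real.log 2))) := by
  unfold besselJ besselPhi
  rw [← tsum_mul_left]
  refine tsum_congr fun k => ?_
  have h1 : Complex.Gamma (k + ν + 1) = (Real.Gamma (k + ν + 1) : ℂ) := by
    rw [← Complex.Gamma_ofReal]; push_cast; rfl
  rw [h1, neg_pow (Complex.exp _), ← Complex.exp_nat_mul, besselCoeff, add_mul, Complex.exp_add]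
  push_cast
  rw [show (k : ℂ) * (2 * (w - Real.log 2)) = 2 * k * (w - Real.log 2) by ring]
  ring

/-- Entire solutions of Bessel's equation of order `ν` in the logarithmic coordinate. -/
structure IsBesselSolution (ν : ℝ) (y : ℂ → ℂ) : Prop where
  differentiable : Differentiable ℂ y
  hasDerivAt_deriv : ∀ w, HasDerivAt (deriv y) ((ν ^ 2 - Complex.exp (2 * w)) * y w) w

lemma IsBesselSolution.hasDerivAt {ν : ℝ} {y : ℂ → ℂ} (h : IsBesselSolution ν y) (w : ℂ) :
    HasDerivAt y (deriv y w) w := (h.differentiable w).hasDerivAt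

lemma isBesselSolution_besselJ (ν : ℝ) : IsBesselSolution ν (besselJ ν) := by
  set L : ℂ := (Real.log 2 : ℂ)
  have hE : ∀ w : ℂ, HasDerivAt (fun w : ℂ => Complex.exp (ν * (w - L)))
      (Complex.exp (ν * (w - L)) * ν) w := fun w => by
    simpa using (((hasDerivAt_id w).sub_const L).const_mul (ν : ℂ)).cexp
  have hq : ∀ w : ℂ, HasDerivAt (fun w : ℂ => -Complex.exp (2 * (w - L)))
      (2 * -Complex.exp (2 * (w - L))) w := fun w => by
    have := ((((hasDerivAt_id w).sub_const L).const_mul (2 : ℂ)).cexp).neg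
    refine this.congr_deriv ?_
    simp
    ring
  have hP : ∀ (μ : ℝ) (w : ℂ), HasDerivAt (fun w : ℂ => besselPhi μ (-Complex.exp (2 * (w - L))))
      (besselPhi (μ + 1) (-Complex.exp (2 * (w - L))) * (2 * -Complex.exp (2 * (w - L)))) w :=
    fun μ w => (hasDerivAt_besselPhi μ _).comp w (hq w)
  have hJ : besselJ ν = fun w => Complex.exp (ν * (w - L)) *
      besselPhi ν (-Complex.exp (2 * (w - L))) := funext (besselJ_eq ν)
  have h1 : ∀ w, HasDerivAt (besselJ ν) (Complex.exp (ν * (w - L)) *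
      (ν * besselPhi ν (-Complex.exp (2 * (w - L))) + (2 * -Complex.exp (2 * (w - L))) *
        besselPhi (ν + 1) (-Complex.exp (2 * (w - L))))) w := fun w => by
    rw [hJ]
    refine ((hE w).mul (hP ν w)).congr_deriv ?_
    ring
  refine ⟨fun w => (h1 w).differentiableAt, fun w => ?_⟩
  have hd := funext fun w => (h1 w).deriv
  rw [hd]
  refine ((hE w).mul (((hP ν w).const_mul (ν : ℂ)).add
    (((hq w).const_mul 2).mul (hP (ν + 1) w)))).congr_deriv ?_
  have h4 : Complex.exp (2 * w) = 4 * Complex.exp (2 * (w - L)) := by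
    have : Complex.exp (2 * L) = 4 := by
      rw [two_mul, Complex.exp_add, ← Complex.ofReal_exp, Real.exp_log (by norm_num)]; norm_num
    rw [← this, ← Complex.exp_add]; ring_nf
  have hc := besselPhi_contiguous ν (-Complex.exp (2 * (w - L)))
  rw [h4, hJ]
  simp only [Pi.add_apply, Pi.mul_apply]
  rw [show ν + 1 + 1 = ν + 2 by ring]
  set q := -Complex.exp (2 * (w - L)) with hqd
  rw [show Complex.exp (2 * (w - L)) = -q by rw [hqd]; ring]
  linear_combination (-4 * q * Complex.exp (ν * (w - L))) * hc

lemma besselJ_add_int_mul_pi (ν : ℝ) (k : ℤ) (w : ℂ) :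
    besselJ ν (w + k * Real.pi * Complex.I) =
      Complex.exp (ν * (k * Real.pi * Complex.I)) * besselJ ν w := by
  have h : Complex.exp (2 * (w + k * Real.pi * Complex.I - Real.log 2)) =
      Complex.exp (2 * (w - Real.log 2)) := by
    rw [show 2 * (w + k * Real.pi * Complex.I - Real.log 2) =
      2 * (w - Real.log 2) + k * (2 * Real.pi * Complex.I) by ring, Complex.exp_add,
      Complex.exp_int_mul_two_pi_mul_I, mul_one]
  rw [besselJ_eq, besselJ_eq, h, ← mul_assoc, ← Complex.exp_add]
  ring_nf

/-! ### Growth of the modified Bessel functions on the positive half-line -/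

/-- The modified Bessel function `I_ν(x)` of real order at positive real `x`. -/
noncomputable def besselI (ν x : ℝ) : ℝ :=
  (x / 2) ^ ν * ∑' k : ℕ, besselCoeff ν k * (x ^ 2 / 4) ^ k

lemma summable_besselCoeff_mul_pow (ν q : ℝ) :
    Summable fun k : ℕ => besselCoeff ν k * q ^ k := by
  rw [← Complex.summable_ofReal]
  refine (congrArg Summable (funext fun k => ?_)).mpr (summable_besselPhi ν q)
  push_cast
  rfl

lemma ofReal_tsum_besselCoeff (ν q : ℝ) :
    ((∑' k : ℕ, besselCoeff ν k * q ^ k : ℝ) : ℂ) = besselPhi ν q := by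
  simp [besselPhi, Complex.ofReal_tsum]

lemma besselJ_ray (ν : ℝ) {x : ℝ} (hx : 0 < x) :
    besselJ ν (Real.log x - Real.pi / 2 * Complex.I) =
      Complex.exp (-(Real.pi / 2 * ν * Complex.I)) * besselI ν x := by
  have h2 : Complex.exp (2 * (Real.log x - Real.pi / 2 * Complex.I - Real.log 2)) =
      -((x ^ 2 / 4 : ℝ) : ℂ) := by
    rw [show (2 : ℂ) * (Real.log x - Real.pi / 2 * Complex.I - Real.log 2) =
      ((2 * (Real.log x - Real.log 2) : ℝ) : ℂ) - Real.pi * Complex.I by push_cast; ring,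
      Complex.exp_sub, Complex.exp_pi_mul_I, ← Complex.ofReal_exp,
      ← Real.log_div hx.ne' two_ne_zero, two_mul, Real.exp_add, Real.exp_log (by positivity)]
    push_cast
    ring
  have h1 : (((x / 2) ^ ν : ℝ) : ℂ) = Complex.exp (ν * (Real.log x - Real.log 2)) := by
    rw [Real.rpow_def_of_pos (by positivity), Real.log_div hx.ne' two_ne_zero]
    push_cast
    ring_nf
  rw [besselJ_eq, h2, besselI, Complex.ofReal_mul, ofReal_tsum_besselCoeff, h1, ← mul_assoc,
    ← Complex.exp_add, neg_neg]
  ring_nf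

lemma besselI_eq_add (ν : ℝ) {x : ℝ} (hx : 0 < x) :
    besselI ν x = besselI (ν + 2) x + 2 * (ν + 1) / x * besselI (ν + 1) x := by
  have h : ∑' k : ℕ, besselCoeff ν k * (x ^ 2 / 4) ^ k =
      x ^ 2 / 4 * (∑' k : ℕ, besselCoeff (ν + 2) k * (x ^ 2 / 4) ^ k) +
        (ν + 1) * ∑' k : ℕ, besselCoeff (ν + 1) k * (x ^ 2 / 4) ^ k := by
    have := besselPhi_contiguous ν ((x ^ 2 / 4 : ℝ) : ℂ)
    simp only [← ofReal_tsum_besselCoeff] at this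
    exact_mod_cast this
  unfold besselI
  rw [h, Real.rpow_add (by positivity), Real.rpow_add (by positivity), Real.rpow_one,
    Real.rpow_two]
  field_simp
  ring

lemma integral_rpow_mul_one_sub_rpow {a b : ℝ} (ha : 0 < a) (hb : 0 < b) :
    ∫ y in (0 : ℝ)..1, y ^ (a - 1) * (1 - y) ^ (b - 1) =
      Real.Gamma a * Real.Gamma b / Real.Gamma (a + b) := by
  have h := ProbabilityTheory.beta_eq_betaIntegralReal a b ha hb
  have h2 : Complex.betaIntegral a b =
      ((∫ y in (0 : ℝ)..1, y ^ (a - 1) * (1 - y) ^ (b - 1) : ℝ) : ℂ) := by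
    rw [Complex.betaIntegral, ← intervalIntegral.integral_ofReal]
    refine intervalIntegral.integral_congr fun y hy => ?_
    rw [Set.uIcc_of_le zero_le_one] at hy
    rw [Complex.ofReal_mul, Complex.ofReal_cpow hy.1, Complex.ofReal_cpow (by linarith [hy.2])]
    push_cast
    rfl
  rw [h2, Complex.ofReal_re] at h
  rw [← h, ProbabilityTheory.beta]

/-- Poisson-type integral for `I_ν`, in the form adapted to Laplace's method at `y = 0`.  For
`y > 1` the integrand vanishes because `√(1 - y) = 0` there. -/
lemma integral_sinh_mul_rpow {a : ℝ} (ha : 1 ≤ a) {x : ℝ} (hx : 0 ≤ x) :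
    ∫ y in Set.Ioi (0 : ℝ), Real.sinh (x * √(1 - y)) * y ^ (a - 1) =
      √Real.pi / 2 * Real.Gamma a * x *
        ∑' k : ℕ, besselCoeff (a + 1 / 2) k * (x ^ 2 / 4) ^ k := by
  set F : ℕ → ℝ → ℝ := fun k y =>
    x ^ (2 * k + 1) / (2 * k + 1).factorial * (y ^ (a - 1) * (1 - y) ^ ((k + 3 / 2 : ℝ) - 1))
    with hF
  have hk0 : ∀ k : ℕ, (0 : ℝ) ≤ k := fun k => k.cast_nonneg
  have hcont : ∀ k, Continuous (F k) := fun k => by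
    have h1 : Continuous fun y : ℝ => y ^ (a - 1) := Real.continuous_rpow_const (by linarith)
    have h2 : Continuous fun y : ℝ => (1 - y) ^ ((k + 3 / 2 : ℝ) - 1) :=
      (Real.continuous_rpow_const (by linarith [hk0 k])).comp
        (by fun_prop : Continuous fun y : ℝ => 1 - y)
    exact continuous_const.mul (h1.mul h2)
  have hGam : ∀ k : ℕ, Real.Gamma (k + 3 / 2) =
      (2 * k + 1).factorial / (k.factorial * 4 ^ k) * (√Real.pi / 2) := fun k => by
    have := Real.Gamma_mul_Gamma_add_half (k + 1)
    rw [Real.Gamma_nat_eq_factorial, show (k : ℝ) + 1 + 1 / 2 = k + 3 / 2 by ring,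
      show 2 * ((k : ℝ) + 1) = ((2 * k + 1 : ℕ) : ℝ) + 1 by push_cast; ring,
      Real.Gamma_nat_eq_factorial,
      show 1 - (((2 * k + 1 : ℕ) : ℝ) + 1) = -((2 * k + 1 : ℕ) : ℝ) by push_cast; ring,
      Real.rpow_neg zero_le_two, Real.rpow_natCast, pow_succ, pow_mul,
      show (2 : ℝ) ^ 2 = 4 by norm_num] at this
    have hf : (k.factorial : ℝ) ≠ 0 := by positivity
    field_simp at this ⊢
    linarith
  have hint : ∀ k, ∫ y in Set.Ioc (0 : ℝ) 1, F k y =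
      √Real.pi / 2 * Real.Gamma a * x * (besselCoeff (a + 1 / 2) k * (x ^ 2 / 4) ^ k) :=
    fun k => by
    have hG : Real.Gamma (a + (k + 3 / 2)) ≠ 0 :=
      (Real.Gamma_pos_of_pos (by linarith [hk0 k])).ne'
    rw [← intervalIntegral.integral_of_le zero_le_one, hF]
    simp only
    rw [intervalIntegral.integral_const_mul,
      integral_rpow_mul_one_sub_rpow (by linarith) (by linarith [hk0 k]), hGam, besselCoeff,
      show (k : ℝ) + (a + 1 / 2) + 1 = a + (k + 3 / 2) by ring, pow_succ, pow_mul, div_pow]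
    field_simp
  have hnorm : ∀ k, ∫ y in Set.Ioc (0 : ℝ) 1, ‖F k y‖ = ∫ y in Set.Ioc (0 : ℝ) 1, F k y :=
    fun k => by
    refine integral_congr_ae ?_
    filter_upwards [ae_restrict_mem measurableSet_Ioc] with y hy
    refine Real.norm_of_nonneg ?_
    change 0 ≤ x ^ (2 * k + 1) / (2 * k + 1).factorial *
      (y ^ (a - 1) * (1 - y) ^ ((k + 3 / 2 : ℝ) - 1))
    have h1 : 0 ≤ y ^ (a - 1) := Real.rpow_nonneg hy.1.le _
    have h2 : 0 ≤ (1 - y) ^ ((k + 3 / 2 : ℝ) - 1) := Real.rpow_nonneg (by linarith [hy.2]) _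
    exact mul_nonneg (div_nonneg (pow_nonneg hx _) (Nat.cast_nonneg _)) (mul_nonneg h1 h2)
  have hsum : Summable fun k : ℕ => √Real.pi / 2 * Real.Gamma a * x *
      (besselCoeff (a + 1 / 2) k * (x ^ 2 / 4) ^ k) := by
    exact (summable_besselCoeff_mul_pow (a + 1 / 2) (x ^ 2 / 4)).mul_left _
  have hS := hasSum_integral_of_summable_integral_norm (μ := volume.restrict (Set.Ioc (0 : ℝ) 1))
    (F := F) (fun k => (hcont k).integrableOn_Ioc) (by simpa only [hnorm, hint] using hsum)
  simp only [hint] at hS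
  have hext : ∫ y in Set.Ioi (0 : ℝ), Real.sinh (x * √(1 - y)) * y ^ (a - 1) =
      ∫ y in Set.Ioc (0 : ℝ) 1, Real.sinh (x * √(1 - y)) * y ^ (a - 1) := by
    refine setIntegral_eq_of_subset_of_forall_sdiff_eq_zero measurableSet_Ioi
      Set.Ioc_subset_Ioi_self fun y hy => ?_
    have : 1 < y := by
      by_contra h
      exact hy.2 ⟨hy.1, not_lt.mp h⟩
    rw [Real.sqrt_eq_zero_of_nonpos (by linarith), mul_zero, Real.sinh_zero, zero_mul]
  rw [hext, ← tsum_mul_left, hS.tsum_eq]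
  refine setIntegral_congr_fun measurableSet_Ioc fun y hy => ?_
  have h1 := (Real.hasSum_sinh (x * √(1 - y))).mul_right (y ^ (a - 1))
  rw [← h1.tsum_eq]
  refine tsum_congr fun k => ?_
  have h2 : (1 - y) ^ ((k + 3 / 2 : ℝ) - 1) = √(1 - y) ^ (2 * k + 1) := by
    rw [Real.sqrt_eq_rpow, ← Real.rpow_natCast, ← Real.rpow_mul (by linarith [hy.2])]
    congr 1
    push_cast
    ring
  rw [hF, mul_pow]
  simp only
  rw [h2]
  ring

lemma tendsto_integral_sinh_mul_rpow {a : ℝ} (ha : 1 ≤ a) :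
    Tendsto (fun x : ℝ => x ^ a * Real.exp (-x) *
      ∫ y in Set.Ioi (0 : ℝ), Real.sinh (x * √(1 - y)) * y ^ (a - 1)) atTop
      (𝓝 (2 ^ (a - 1) * Real.Gamma a)) := by
  -- After the substitution `y = v / x` the integrand converges to `e^{-v/2} v^{a-1} / 2`.
  have hsub : ∀ x : ℝ, 0 < x → ∫ v in Set.Ioi (0 : ℝ),
      Real.exp (-x) * Real.sinh (x * √(1 - x⁻¹ * v)) * v ^ (a - 1) =
      x ^ a * Real.exp (-x) *
        ∫ y in Set.Ioi (0 : ℝ), Real.sinh (x * √(1 - y)) * y ^ (a - 1) := fun x hx => by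
    have h := integral_comp_mul_left_Ioi
      (fun y => Real.sinh (x * √(1 - y)) * y ^ (a - 1)) 0 (inv_pos.mpr hx)
    rw [mul_zero, inv_inv, smul_eq_mul] at h
    have h2 : x ^ a = x ^ (a - 1) * x := by
      rw [← Real.rpow_add_one hx.ne', sub_add_cancel]
    rw [h2, show x ^ (a - 1) * x * Real.exp (-x) *
        ∫ y in Set.Ioi (0 : ℝ), Real.sinh (x * √(1 - y)) * y ^ (a - 1) =
      x ^ (a - 1) * Real.exp (-x) *
        (x * ∫ y in Set.Ioi (0 : ℝ), Real.sinh (x * √(1 - y)) * y ^ (a - 1)) by ring, ← h,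
      ← integral_const_mul]
    refine setIntegral_congr_fun measurableSet_Ioi fun v hv => ?_
    have hv' : (0 : ℝ) ≤ v := le_of_lt hv
    rw [Real.mul_rpow (inv_nonneg.mpr hx.le) hv', Real.inv_rpow hx.le]
    have := (Real.rpow_pos_of_pos hx (a - 1)).ne'
    field_simp
  have hval : ∫ v in Set.Ioi (0 : ℝ), Real.exp (-(1 / 2) * v) / 2 * v ^ (a - 1) =
      2 ^ (a - 1) * Real.Gamma a := by
    have h := Real.integral_rpow_mul_exp_neg_mul_Ioi (a := a) (r := 1 / 2) (by linarith)
      (by norm_num)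
    rw [Real.rpow_sub_one two_ne_zero, show (1 : ℝ) / (1 / 2) = 2 by norm_num] at *
    rw [show 2 ^ a / 2 * Real.Gamma a = 1 / 2 * (2 ^ a * Real.Gamma a) by ring, ← h,
      ← integral_const_mul]
    refine setIntegral_congr_fun measurableSet_Ioi fun v hv => ?_
    rw [neg_mul]
    ring
  rw [← hval]
  refine (tendsto_congr' ?_).mp (tendsto_integral_filter_of_dominated_convergence
    (F := fun x v => Real.exp (-x) * Real.sinh (x * √(1 - x⁻¹ * v)) * v ^ (a - 1))
    (μ := volume.restrict (Set.Ioi (0 : ℝ)))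
    (fun v => Real.exp (-(1 / 2) * v) * v ^ (a - 1)) ?_ ?_ ?_ ?_)
  · filter_upwards [eventually_gt_atTop 0] with x hx using hsub x hx
  · refine .of_forall fun x => Measurable.aestronglyMeasurable ?_
    have : Measurable fun v : ℝ => v ^ (a - 1) :=
      (Real.continuous_rpow_const (by linarith)).measurable
    fun_prop
  · filter_upwards [eventually_gt_atTop 0] with x hx
    filter_upwards [ae_restrict_mem measurableSet_Ioi] with v hv
    have hv' : (0 : ℝ) < v := hv
    have hs : 0 ≤ Real.sinh (x * √(1 - x⁻¹ * v)) :=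
      Real.sinh_nonneg_iff.mpr (by positivity)
    rw [Real.norm_of_nonneg (by positivity)]
    gcongr
    rcases le_or_gt v x with h | h
    · have h1 : √(1 - x⁻¹ * v) ≤ 1 - x⁻¹ * v / 2 := by
        have : x⁻¹ * v ≤ 1 := by rw [inv_mul_le_iff₀ hx]; linarith
        rw [Real.sqrt_le_left (by linarith)]
        nlinarith [sq_nonneg (x⁻¹ * v)]
      have h2 : x * √(1 - x⁻¹ * v) ≤ x - v / 2 := by
        calc x * √(1 - x⁻¹ * v) ≤ x * (1 - x⁻¹ * v / 2) := by gcongr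
          _ = x - v / 2 := by field_simp
      have h3 : Real.sinh (x * √(1 - x⁻¹ * v)) ≤ Real.exp (x - v / 2) := by
        refine le_trans ?_ (Real.exp_le_exp.mpr h2)
        rw [Real.sinh_eq]
        linarith [Real.exp_pos (x * √(1 - x⁻¹ * v)), Real.exp_pos (-(x * √(1 - x⁻¹ * v)))]
      calc Real.exp (-x) * Real.sinh (x * √(1 - x⁻¹ * v))
          ≤ Real.exp (-x) * Real.exp (x - v / 2) := by gcongr
        _ = Real.exp (-(1 / 2) * v) := by rw [← Real.exp_add]; ring_nf
    · have : 1 < x⁻¹ * v := by rw [lt_inv_mul_iff₀ hx]; linarith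
      rw [Real.sqrt_eq_zero_of_nonpos (by linarith), mul_zero, Real.sinh_zero, mul_zero]
      positivity
  · have h := integrableOn_rpow_mul_exp_neg_mul_rpow (p := 1) (s := a - 1) (b := 1 / 2)
      (by linarith) one_pos (by norm_num)
    refine h.congr_fun (fun v _ => ?_) measurableSet_Ioi
    simp only [Real.rpow_one]
    ring
  · filter_upwards [ae_restrict_mem measurableSet_Ioi] with v hv
    refine Tendsto.mul_const _ ?_
    have hi : Tendsto (fun x : ℝ => √(1 - x⁻¹ * v)) atTop (𝓝 1) := by
      have : Tendsto (fun x : ℝ => √(1 - x⁻¹ * v)) atTop (𝓝 √(1 - 0 * v)) :=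
        ((tendsto_inv_atTop_zero.mul_const v).const_sub 1).sqrt
      simpa using this
    have h1 : Tendsto (fun x : ℝ => Real.exp (-v / (1 + √(1 - x⁻¹ * v)))) atTop
        (𝓝 (Real.exp (-(1 / 2) * v))) := by
      have h := ((hi.const_add 1).inv₀ (by norm_num)).const_mul (-v)
      rw [show -v * (1 + 1)⁻¹ = -(1 / 2) * v by ring] at h
      exact h.rexp
    have h2 : Tendsto (fun x : ℝ => Real.exp (-x) * Real.exp (-(x * √(1 - x⁻¹ * v)))) atTop
        (𝓝 0) := by
      refine squeeze_zero' (.of_forall fun x => by positivity) ?_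
        Real.tendsto_exp_neg_atTop_nhds_zero
      filter_upwards [eventually_gt_atTop 0] with x hx
      refine mul_le_of_le_one_right (Real.exp_pos _).le (Real.exp_le_one_iff.mpr ?_)
      have := mul_nonneg hx.le (Real.sqrt_nonneg (1 - x⁻¹ * v))
      linarith
    have h3 := (h1.sub h2).div_const 2
    rw [sub_zero] at h3
    refine (tendsto_congr' ?_).mp h3
    filter_upwards [eventually_gt_atTop 0, eventually_ge_atTop v] with x hx hxv
    have hle : x⁻¹ * v ≤ 1 := by rw [inv_mul_le_iff₀ hx]; linarith
    have h4 : -v / (1 + √(1 - x⁻¹ * v)) = -x + x * √(1 - x⁻¹ * v) := by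
      have hsq := Real.sq_sqrt (show 0 ≤ 1 - x⁻¹ * v by linarith)
      have hp : 0 < 1 + √(1 - x⁻¹ * v) := by positivity
      rw [div_eq_iff hp.ne']
      have : x * √(1 - x⁻¹ * v) ^ 2 = x - v := by rw [hsq]; field_simp
      linear_combination -this
    rw [h4, Real.exp_add, Real.sinh_eq]
    ring

/-- `I_ν(x) ∼ e^x / √(2πx)`.  That the constant does not depend on `ν` is what makes the
combination `I_{-ν} - I_ν` recessive. -/
lemma tendsto_besselI (ν : ℝ) :
    Tendsto (fun x : ℝ => √x * Real.exp (-x) * besselI ν x) atTop (𝓝 (√(2 * Real.pi))⁻¹) := by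
  obtain ⟨m, hm⟩ := exists_nat_ge (3 / 2 - ν)
  replace hm : 3 / 2 - (m : ℝ) ≤ ν := by linarith
  induction m using Nat.strong_induction_on generalizing ν with
  | _ m ih =>
  rcases le_or_gt (3 / 2) ν with hν | hν
  · obtain ⟨a, rfl⟩ : ∃ a, ν = a + 1 / 2 := ⟨ν - 1 / 2, by ring⟩
    have ha : 1 ≤ a := by linarith
    have hG : 0 < Real.Gamma a := Real.Gamma_pos_of_pos (by linarith)
    -- For `ν = a + 1/2` with `a ≥ 1` the Poisson integral applies.
    have h := (tendsto_integral_sinh_mul_rpow ha).const_mul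
      (2 ^ (1 / 2 - a) / (√Real.pi * Real.Gamma a))
    have hc : (2 : ℝ) ^ (1 / 2 - a) / (√Real.pi * Real.Gamma a) * (2 ^ (a - 1) * Real.Gamma a) =
        (√(2 * Real.pi))⁻¹ := by
      have h2 : (2 : ℝ) ^ (1 / 2 - a) * 2 ^ (a - 1) = (√2)⁻¹ := by
        rw [← Real.rpow_add two_pos, Real.sqrt_eq_rpow, ← Real.rpow_neg zero_le_two]
        ring_nf
      rw [Real.sqrt_mul zero_le_two, mul_inv, ← h2]
      field_simp
    rw [hc] at h
    refine (tendsto_congr' ?_).mp h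
    filter_upwards [eventually_gt_atTop 0] with x hx
    rw [integral_sinh_mul_rpow ha hx.le, besselI, Real.div_rpow hx.le zero_le_two,
      Real.sqrt_eq_rpow x, Real.rpow_add hx, Real.rpow_add two_pos, Real.rpow_sub two_pos]
    have hx2 : x ^ (1 / 2 : ℝ) * x ^ (1 / 2 : ℝ) = x := by
      rw [← Real.rpow_add hx]; norm_num
    have ht2 : (2 : ℝ) ^ (1 / 2 : ℝ) * 2 ^ (1 / 2 : ℝ) = 2 := by
      rw [← Real.rpow_add two_pos]; norm_num
    have h2a : (0 : ℝ) < 2 ^ a := by positivity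
    have h2h : (0 : ℝ) < 2 ^ (1 / 2 : ℝ) := by positivity
    have hp : 0 < √Real.pi := by positivity
    set S := ∑' k : ℕ, besselCoeff (a + 1 / 2) k * (x ^ 2 / 4) ^ k
    field_simp
    linear_combination S * (x ^ (1 / 2 : ℝ)) ^ 2 * ht2 - S * ((2 : ℝ) ^ (1 / 2 : ℝ)) ^ 2 * hx2
  · have hm0 : m ≠ 0 := by
      rintro rfl
      simp only [CharP.cast_eq_zero] at hm
      linarith
    obtain ⟨p, rfl⟩ := Nat.exists_eq_succ_of_ne_zero hm0
    -- Downward recurrence: the term `I_{ν+1}` enters with the factor `2(ν+1)/x → 0`.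
    have h1 := ih p (Nat.lt_succ_self _) (ν + 1) (by push_cast at hm; linarith)
    have h2 := ih p (Nat.lt_succ_self _) (ν + 2) (by push_cast at hm; linarith)
    have h3 := h2.add ((tendsto_inv_atTop_zero.const_mul (2 * (ν + 1))).mul h1)
    rw [mul_zero, zero_mul, add_zero] at h3
    refine (tendsto_congr' ?_).mp h3
    filter_upwards [eventually_gt_atTop 0] with x hx
    rw [besselI_eq_add ν hx]
    ring

/-! ### Decay of the Hankel function in the closed lower half-plane -/

lemma IsBesselSolution.const_mul_add_const_mul {ν : ℝ} {f g : ℂ → ℂ} (hf : IsBesselSolution ν f)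
    (hg : IsBesselSolution ν g) (a b : ℂ) : IsBesselSolution ν fun w => a * f w + b * g w := by
  have h : ∀ w, HasDerivAt (fun w => a * f w + b * g w) (a * deriv f w + b * deriv g w) w :=
    fun w => ((hf.hasDerivAt w).const_mul a).add ((hg.hasDerivAt w).const_mul b)
  refine ⟨fun w => (h w).differentiableAt, fun w => ?_⟩
  rw [funext fun w => (h w).deriv]
  refine (((hf.hasDerivAt_deriv w).const_mul a).add
    ((hg.hasDerivAt_deriv w).const_mul b)).congr_deriv ?_
  ring

lemma hankel2_eq (ν : ℝ) (w : ℂ) :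
    hankel2 ν w = (-Complex.I * Complex.sin (Real.pi * ν))⁻¹ * besselJ ((-ν : ℝ) : ℂ) w +
      -((-Complex.I * Complex.sin (Real.pi * ν))⁻¹ * Complex.exp (Complex.I * Real.pi * ν)) *
        besselJ ν w := by
  rw [hankel2, Complex.ofReal_neg, div_eq_mul_inv]
  ring

lemma isBesselSolution_hankel2 (ν : ℝ) : IsBesselSolution ν (hankel2 ν) := by
  have h := isBesselSolution_besselJ (-ν)
  have h' : IsBesselSolution ν (besselJ ((-ν : ℝ) : ℂ)) :=
    ⟨h.1, fun w => by simpa using h.2 w⟩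
  rw [funext (hankel2_eq ν)]
  exact h'.const_mul_add_const_mul (isBesselSolution_besselJ ν) _ _

/-- Energy estimate: with `P = √r y` and `Q = dP/dr`, the energy `|P|² + |Q|²` changes at the
integrable relative rate `|ν² - 1/4| / r²`. -/
lemma IsBesselSolution.exists_norm_le_of_im_eq {ν : ℝ} {y : ℂ → ℂ} (h : IsBesselSolution ν y)
    (k : ℤ) : ∃ C, ∀ t : ℝ, 0 ≤ t →
      ‖Complex.exp (t / 2) * y (t + k * Real.pi * Complex.I)‖ ≤ C := by
  set α : ℂ := k * Real.pi * Complex.I with hα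
  set c : ℝ := ν ^ 2 - 1 / 4 with hc
  set P : ℝ → ℂ := fun t => Complex.exp (1 / 2 * t) * y (t + α) with hPdef
  set Q : ℝ → ℂ := fun t => Complex.exp (-(1 / 2) * t) * (y (t + α) / 2 + deriv y (t + α))
    with hQdef
  have hline : ∀ t : ℝ, HasDerivAt (fun t : ℝ => (t : ℂ) + α) 1 t := fun t =>
    (Complex.ofRealCLM.hasDerivAt (x := t)).add_const α
  have hy : ∀ t : ℝ, HasDerivAt (fun t : ℝ => y (t + α)) (deriv y (t + α)) t := fun t => by
    have h1 := (h.hasDerivAt (t + α)).comp t (hline t)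
    rw [mul_one] at h1
    exact h1
  have hy' : ∀ t : ℝ, HasDerivAt (fun t : ℝ => deriv y (t + α))
      ((ν ^ 2 - Complex.exp (2 * t)) * y (t + α)) t := fun t => by
    have h1 := (h.hasDerivAt_deriv (t + α)).comp t (hline t)
    have h2 : Complex.exp (2 * (t + α)) = Complex.exp (2 * t) := by
      rw [hα, show (2 : ℂ) * (t + k * Real.pi * Complex.I) =
        2 * t + k * (2 * Real.pi * Complex.I) by ring, Complex.exp_add,
        Complex.exp_int_mul_two_pi_mul_I, mul_one]
    rw [h2, mul_one] at h1
    exact h1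
  have he : ∀ (a : ℂ) (t : ℝ), HasDerivAt (fun t : ℝ => Complex.exp (a * t))
      (a * Complex.exp (a * t)) t := fun a t => by
    have := ((Complex.ofRealCLM.hasDerivAt (x := t)).const_mul a).cexp
    simpa [mul_comm] using this
  have hP : ∀ t, HasDerivAt P (Real.exp t • Q t) t := fun t => by
    have h2 : Complex.exp ((1 / 2) * t) = Complex.exp t * Complex.exp (-(1 / 2) * t) := by
      rw [← Complex.exp_add]; ring_nf
    refine ((he (1 / 2) t).mul (hy t)).congr_deriv ?_
    rw [Complex.real_smul, Complex.ofReal_exp, hQdef, h2]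
    ring
  have hQ : ∀ t, HasDerivAt Q ((c * Real.exp (-t) - Real.exp t) • P t) t := fun t => by
    refine ((he (-(1 / 2)) t).mul (((hy t).div_const 2).add (hy' t))).congr_deriv ?_
    have h1 : Complex.exp t = Complex.exp (1 / 2 * t) ^ 2 := by
      rw [← Complex.exp_nat_mul]; push_cast; ring_nf
    have h2 : Complex.exp (2 * t) = Complex.exp (1 / 2 * t) ^ 4 := by
      rw [← Complex.exp_nat_mul]; push_cast; ring_nf
    have h3 := Complex.exp_ne_zero (1 / 2 * t)
    rw [Complex.real_smul, hPdef]
    simp only [Pi.add_apply]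
    push_cast
    rw [h2, neg_mul (1 / 2 : ℂ) (t : ℂ), Complex.exp_neg, Complex.exp_neg, h1, hc]
    push_cast
    field_simp
    ring
  set E : ℝ → ℝ := fun t => ‖P t‖ ^ 2 + ‖Q t‖ ^ 2 with hE
  set G : ℝ → ℝ := fun t => E t * Real.exp (|c| * Real.exp (-t)) with hG
  have hE' : ∀ t, HasDerivAt E (2 * c * Real.exp (-t) * inner ℝ (Q t) (P t)) t := fun t => by
    refine ((hP t).norm_sq.add (hQ t).norm_sq).congr_deriv ?_
    rw [inner_smul_right, inner_smul_right, real_inner_comm (Q t) (P t)]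
    ring
  have hx : ∀ t, HasDerivAt (fun t : ℝ => Real.exp (|c| * Real.exp (-t)))
      (Real.exp (|c| * Real.exp (-t)) * (|c| * -Real.exp (-t))) t := fun t => by
    simpa using ((((hasDerivAt_id t).neg).exp).const_mul |c|).exp
  have hanti : Antitone G := by
    refine antitone_of_deriv_nonpos (fun t => ((hE' t).mul (hx t)).differentiableAt) fun t => ?_
    rw [show deriv G t = _ from ((hE' t).mul (hx t)).deriv]
    have h1 : 2 * c * inner ℝ (Q t) (P t) ≤ |c| * E t := by
      calc 2 * c * inner ℝ (Q t) (P t) ≤ |2 * c * inner ℝ (Q t) (P t)| := le_abs_self _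
        _ = |c| * (2 * |inner ℝ (Q t) (P t)|) := by
          rw [abs_mul, abs_mul, abs_two]; ring
        _ ≤ |c| * (2 * (‖Q t‖ * ‖P t‖)) := by
          gcongr; exact abs_real_inner_le_norm _ _
        _ ≤ |c| * E t := by
          gcongr
          rw [hE]
          nlinarith [sq_nonneg (‖Q t‖ - ‖P t‖)]
    have h2 : 0 < Real.exp (-t) * Real.exp (|c| * Real.exp (-t)) := by positivity
    nlinarith
  refine ⟨√(G 0), fun t ht => Real.le_sqrt_of_sq_le ?_⟩
  rw [show (t : ℂ) / 2 = 1 / 2 * t by ring]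
  have h1 : E t ≤ G t := by
    refine le_mul_of_one_le_right (by positivity) (Real.one_le_exp (by positivity))
  have h2 : ‖P t‖ ^ 2 ≤ E t := le_add_of_nonneg_right (by positivity)
  exact h2.trans (h1.trans (hanti ht))

/-- The Wronskian of two solutions is constant. -/
lemma IsBesselSolution.exists_wronskian_eq {ν : ℝ} {f g : ℂ → ℂ} (hf : IsBesselSolution ν f)
    (hg : IsBesselSolution ν g) : ∃ W : ℂ, ∀ w, deriv f w * g w - f w * deriv g w = W := by
  have h : ∀ w, HasDerivAt (fun w => deriv f w * g w - f w * deriv g w) 0 w := fun w => by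
    refine (((hf.hasDerivAt_deriv w).mul (hg.hasDerivAt w)).sub
      ((hf.hasDerivAt w).mul (hg.hasDerivAt_deriv w))).congr_deriv ?_
    ring
  refine ⟨deriv f 0 * g 0 - f 0 * deriv g 0, fun w => ?_⟩
  exact is_const_of_deriv_eq_zero (fun w => (h w).differentiableAt) (fun w => (h w).deriv) w 0

/-- A function tending to zero at infinity is bounded by the total variation of a majorant. -/
lemma norm_le_of_tendsto_zero_of_norm_deriv_le {g g' : ℝ → ℂ} {B B' : ℝ → ℝ} {T : ℝ}
    (hg : ∀ t, T ≤ t → HasDerivAt g (g' t) t) (hB : ∀ t, T ≤ t → HasDerivAt B (B' t) t)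
    (hle : ∀ t, T ≤ t → ‖g' t‖ ≤ B' t) (hg0 : Tendsto g atTop (𝓝 0))
    (hB0 : Tendsto B atTop (𝓝 0)) {t : ℝ} (ht : T ≤ t) : ‖g t‖ ≤ -B t := by
  have h : ∀ s, t ≤ s → ‖g s - g t‖ ≤ B s - B t := fun s hs => by
    refine image_norm_le_of_norm_deriv_right_le_deriv_boundary' (f := fun s => g s - g t)
      (f' := g') (B := fun s => B s - B t) (B' := B') (a := t) (b := s)
      ?_ ?_ (by simp) ?_ ?_ ?_ (Set.right_mem_Icc.mpr hs)
    · exact fun u hu => ((hg u (ht.trans hu.1)).sub_const _).continuousAt.continuousWithinAt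
    · exact fun u hu => ((hg u (ht.trans hu.1)).sub_const _).hasDerivWithinAt
    · exact fun u hu => ((hB u (ht.trans hu.1)).sub_const _).continuousAt.continuousWithinAt
    · exact fun u hu => ((hB u (ht.trans hu.1)).sub_const _).hasDerivWithinAt
    · exact fun u hu => hle u (ht.trans hu.1)
  have h1 := (hg0.sub_const (g t)).norm
  have h2 := hB0.sub_const (B t)
  rw [zero_sub, norm_neg] at h1
  rw [zero_sub] at h2
  exact le_of_tendsto_of_tendsto h1 h2 ((eventually_ge_atTop t).mono h)

/-- On the negative imaginary axis the quotient `H_ν / J_ν` tends to zero and has derivative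
`W / J_ν²`; hence `H_ν` decays as fast as `J_ν` grows. -/
lemma exists_norm_hankel2_le_on_ray (ν : ℝ) : ∃ C, ∀ᶠ t : ℝ in atTop,
    ‖Complex.exp (t / 2) * hankel2 ν (t - Real.pi / 2 * Complex.I)‖ ≤
      C * Real.exp (-Real.exp t) := by
  set c : ℝ := (√(2 * Real.pi))⁻¹ with hc
  have hc0 : 0 < c := by positivity
  have hlim : ∀ μ : ℝ, Tendsto (fun t : ℝ => √(Real.exp t) * Real.exp (-Real.exp t) *
      besselI μ (Real.exp t)) atTop (𝓝 c) := fun μ =>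
    (tendsto_besselI μ).comp Real.tendsto_exp_atTop
  have hJ : ∀ (μ t : ℝ), besselJ μ (t - Real.pi / 2 * Complex.I) =
      Complex.exp (-(Real.pi / 2 * μ * Complex.I)) * besselI μ (Real.exp t) := fun μ t => by
    have := besselJ_ray μ (Real.exp_pos t)
    rwa [Real.log_exp] at this
  have hnJ : ∀ (μ t : ℝ), ‖besselJ μ (t - Real.pi / 2 * Complex.I)‖ = |besselI μ (Real.exp t)| :=
    fun μ t => by
    rw [hJ, norm_mul, Complex.norm_real, Real.norm_eq_abs, show -((Real.pi : ℂ) / 2 * μ * Complex.I)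
      = ((-(Real.pi / 2 * μ) : ℝ) : ℂ) * Complex.I by push_cast; ring,
      Complex.norm_exp_ofReal_mul_I, one_mul]
  obtain ⟨T, hT⟩ := eventually_atTop.mp (((hlim ν).eventually_const_lt (half_lt_self hc0)).and
    ((hlim ν).eventually_lt_const (lt_two_mul_self hc0)))
  obtain ⟨W, hW⟩ := (isBesselSolution_hankel2 ν).exists_wronskian_eq (isBesselSolution_besselJ ν)
  have hIpos : ∀ t, T ≤ t → 0 < besselI ν (Real.exp t) := fun t ht => by
    by_contra hneg
    have h1 := (hT t ht).1
    have : √(Real.exp t) * Real.exp (-Real.exp t) * besselI ν (Real.exp t) ≤ 0 :=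
      mul_nonpos_of_nonneg_of_nonpos (by positivity) (not_lt.mp hneg)
    linarith
  have hJ0 : ∀ t : ℝ, T ≤ t → besselJ ν (t - Real.pi / 2 * Complex.I) ≠ 0 := fun t ht => by
    rw [← norm_pos_iff, hnJ, abs_of_pos (hIpos t ht)]
    exact hIpos t ht
  set g : ℝ → ℂ := fun t => hankel2 ν (t - Real.pi / 2 * Complex.I) /
    besselJ ν (t - Real.pi / 2 * Complex.I) with hg
  have hg0 : Tendsto g atTop (𝓝 0) := by
    have h1 : Tendsto (fun t : ℝ => besselI (-ν) (Real.exp t) / besselI ν (Real.exp t)) atTop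
        (𝓝 1) := by
      have := (hlim (-ν)).div (hlim ν) hc0.ne'
      rw [div_self hc0.ne'] at this
      refine (tendsto_congr fun t => ?_).mp this
      have : √(Real.exp t) * Real.exp (-Real.exp t) ≠ 0 := by positivity
      simp only [Pi.div_apply]
      rw [mul_div_mul_left _ _ this]
    have h2 := (Complex.continuous_ofReal.tendsto 1).comp h1
    have h3 := (((h2.const_mul (Complex.exp (Complex.I * Real.pi * ν))).sub_const
      (Complex.exp (Complex.I * Real.pi * ν)))).div_const (-Complex.I * Complex.sin (Real.pi * ν))
    simp only [Complex.ofReal_one, mul_one, sub_self, zero_div] at h3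
    refine (tendsto_congr' ?_).mp h3
    filter_upwards [eventually_ge_atTop T] with t ht
    have hI : (besselI ν (Real.exp t) : ℂ) ≠ 0 := by exact_mod_cast (hIpos t ht).ne'
    have hee : Complex.exp (Complex.I * Real.pi * ν) =
        Complex.exp (Real.pi / 2 * ν * Complex.I) * Complex.exp (Real.pi / 2 * ν * Complex.I) := by
      rw [← Complex.exp_add]; ring_nf
    rw [hg]
    simp only [hankel2, Function.comp_apply]
    rw [← Complex.ofReal_neg, hJ, hJ, hee, Complex.exp_neg (Real.pi / 2 * ν * Complex.I),
      div_right_comm]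
    congr 1
    push_cast
    rw [mul_neg, neg_mul, neg_neg]
    field_simp
  have hline : ∀ t : ℝ, HasDerivAt (fun t : ℝ => (t : ℂ) - Real.pi / 2 * Complex.I) 1 t := fun t =>
    (Complex.ofRealCLM.hasDerivAt (x := t)).sub_const _
  have hg' : ∀ t, T ≤ t → HasDerivAt g (W / besselJ ν (t - Real.pi / 2 * Complex.I) ^ 2) t :=
    fun t ht => by
    have h1 := ((isBesselSolution_hankel2 ν).hasDerivAt (t - Real.pi / 2 * Complex.I)).comp t
      (hline t)
    have h2 := ((isBesselSolution_besselJ ν).hasDerivAt (t - Real.pi / 2 * Complex.I)).comp t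
      (hline t)
    refine (h1.div h2 (hJ0 t ht)).congr_deriv ?_
    simp only [Function.comp_apply, mul_one]
    rw [hW]
  set K : ℝ := ‖W‖ * (4 / c ^ 2) with hK
  have hB : ∀ t : ℝ, HasDerivAt (fun t => -(K / 2) * Real.exp (-2 * Real.exp t))
      (K * (Real.exp t * Real.exp (-2 * Real.exp t))) t := fun t => by
    refine ((((Real.hasDerivAt_exp t).const_mul (-2)).exp).const_mul (-(K / 2))).congr_deriv ?_
    ring
  have hB0 : Tendsto (fun t : ℝ => -(K / 2) * Real.exp (-2 * Real.exp t)) atTop (𝓝 0) := by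
    have h1 : Tendsto (fun t : ℝ => -2 * Real.exp t) atTop atBot :=
      Real.tendsto_exp_atTop.const_mul_atTop_of_neg (by norm_num)
    simpa using (Real.tendsto_exp_atBot.comp h1).const_mul (-(K / 2))
  have hle : ∀ t, T ≤ t → ‖W / besselJ ν (t - Real.pi / 2 * Complex.I) ^ 2‖ ≤
      K * (Real.exp t * Real.exp (-2 * Real.exp t)) := fun t ht => by
    have h1 := (hT t ht).1
    have hI := hIpos t ht
    have hsq : (c / 2) ^ 2 ≤ Real.exp t * Real.exp (-2 * Real.exp t) *
        besselI ν (Real.exp t) ^ 2 := by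
      calc (c / 2) ^ 2 ≤ (√(Real.exp t) * Real.exp (-Real.exp t) *
            besselI ν (Real.exp t)) ^ 2 := by gcongr
        _ = _ := by
          rw [mul_pow, mul_pow, Real.sq_sqrt (Real.exp_pos _).le, ← Real.exp_nat_mul]
          push_cast
          ring_nf
    rw [norm_div, norm_pow, hnJ, sq_abs, hK, div_le_iff₀ (by positivity)]
    calc ‖W‖ = ‖W‖ * (4 / c ^ 2) * (c / 2) ^ 2 := by field_simp; norm_num
      _ ≤ ‖W‖ * (4 / c ^ 2) * (Real.exp t * Real.exp (-2 * Real.exp t) *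
        besselI ν (Real.exp t) ^ 2) := by gcongr
      _ = _ := by ring
  refine ⟨K / 2 * (2 * c), ?_⟩
  filter_upwards [eventually_ge_atTop T] with t ht
  have h1 := norm_le_of_tendsto_zero_of_norm_deriv_le hg' (fun t _ => hB t) hle hg0 hB0 ht
  have h2 : hankel2 ν (t - Real.pi / 2 * Complex.I) =
      g t * besselJ ν (t - Real.pi / 2 * Complex.I) := by
    rw [hg]
    simp only
    rw [div_mul_cancel₀ _ (hJ0 t ht)]
  have h3 : ‖Complex.exp (t / 2)‖ = √(Real.exp t) := by
    rw [Complex.norm_exp, ← Real.exp_half]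
    simp
  have h4 := (hT t ht).2
  rw [h2, norm_mul, norm_mul, h3, hnJ, abs_of_pos (hIpos t ht)]
  have h5 : Real.exp (-2 * Real.exp t) =
      Real.exp (-Real.exp t) * Real.exp (-Real.exp t) := by
    rw [← Real.exp_add]; ring_nf
  have hI := hIpos t ht
  have hK0 : 0 ≤ K := by positivity
  calc √(Real.exp t) * (‖g t‖ * besselI ν (Real.exp t))
      ≤ √(Real.exp t) * (-(-(K / 2) * Real.exp (-2 * Real.exp t)) * besselI ν (Real.exp t)) := by
        gcongr
    _ = K / 2 * (√(Real.exp t) * Real.exp (-Real.exp t) * besselI ν (Real.exp t)) *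
        Real.exp (-Real.exp t) := by rw [h5]; ring
    _ ≤ K / 2 * (2 * c) * Real.exp (-Real.exp t) := by gcongr

lemma exists_norm_besselJ_le (ν : ℝ) : ∃ C > 0, ∃ A > 0, ∀ w : ℂ,
    ‖besselJ ν w‖ ≤ C * Real.exp (|ν| * |w.re|) * Real.exp (A * Real.exp w.re) := by
  obtain ⟨C, hC, A, hA, h⟩ := exists_norm_besselPhi_le ν
  refine ⟨Real.exp (-(ν * Real.log 2)) * C, by positivity, √A, by positivity, fun w => ?_⟩
  rw [besselJ_eq, norm_mul, Complex.norm_exp]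
  have h1 : ((ν : ℂ) * (w - Real.log 2)).re = ν * w.re + -(ν * Real.log 2) := by
    rw [Complex.re_ofReal_mul, Complex.sub_re, Complex.ofReal_re]; ring
  have h2 : √(A * ‖-Complex.exp (2 * (w - Real.log 2))‖) ≤ √A * Real.exp w.re := by
    rw [norm_neg, Complex.norm_exp, Real.sqrt_mul hA.le, ← Real.exp_half]
    have hre : (2 * (w - Real.log 2)).re = 2 * (w.re - Real.log 2) := by
      rw [← Complex.ofReal_ofNat, Complex.re_ofReal_mul, Complex.sub_re, Complex.ofReal_re]
    rw [hre]
    gcongr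
    linarith [Real.log_nonneg one_le_two]
  have h3 : ν * w.re ≤ |ν| * |w.re| := by
    rw [← abs_mul]; exact le_abs_self _
  rw [h1, Real.exp_add]
  calc Real.exp (ν * w.re) * Real.exp (-(ν * Real.log 2)) *
        ‖besselPhi ν (-Complex.exp (2 * (w - Real.log 2)))‖
      ≤ Real.exp (|ν| * |w.re|) * Real.exp (-(ν * Real.log 2)) *
        (C * Real.exp (√A * Real.exp w.re)) := by
        gcongr
        exact (h _).trans (by gcongr)
    _ = _ := by ring

lemma exists_norm_hankel2_le (ν : ℝ) : ∃ C > 0, ∃ A > 0, ∀ w : ℂ,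
    ‖hankel2 ν w‖ ≤ C * Real.exp (|ν| * |w.re|) * Real.exp (A * Real.exp w.re) := by
  obtain ⟨C, hC, A, hA, h⟩ := exists_norm_besselJ_le ν
  obtain ⟨C', hC', A', hA', h'⟩ := exists_norm_besselJ_le (-ν)
  set a := (-Complex.I * Complex.sin (Real.pi * ν))⁻¹
  set b := -(a * Complex.exp (Complex.I * Real.pi * ν))
  refine ⟨‖a‖ * C' + ‖b‖ * C + 1, by positivity, max A A', by positivity, fun w => ?_⟩
  have h1 := h w
  have h2 := h' w
  rw [abs_neg] at h2
  rw [hankel2_eq]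
  refine (norm_add_le _ _).trans ?_
  rw [norm_mul, norm_mul]
  set X := Real.exp (|ν| * |w.re|)
  set Y := Real.exp (max A A' * Real.exp w.re)
  have hX : 0 < X := Real.exp_pos _
  have hY : 0 < Y := Real.exp_pos _
  have h3 : Real.exp (A * Real.exp w.re) ≤ Y := by
    apply Real.exp_le_exp.mpr; gcongr; exact le_max_left _ _
  have h4 : Real.exp (A' * Real.exp w.re) ≤ Y := by
    apply Real.exp_le_exp.mpr; gcongr; exact le_max_right _ _
  calc ‖a‖ * ‖besselJ ((-ν : ℝ) : ℂ) w‖ + ‖b‖ * ‖besselJ ν w‖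
      ≤ ‖a‖ * (C' * X * Y) + ‖b‖ * (C * X * Y) := by
        gcongr
        · exact h2.trans (by gcongr)
        · exact h1.trans (by gcongr)
    _ ≤ (‖a‖ * C' + ‖b‖ * C + 1) * X * Y := by nlinarith [mul_pos hX hY]

/-- The function to which the Phragmén–Lindelöf principle is applied: `e^{iz} √z H_ν(z)` in the
variable `ζ = iz` of the right half-plane, with a factor that cancels the singularity at `0` and
does not matter at infinity. -/
noncomputable def scaledHankel (ν : ℝ) (m : ℕ) (ζ : ℂ) : ℂ :=
  (ζ / (1 + ζ)) ^ m * Complex.exp ζ *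
    (Complex.exp ((Complex.log ζ - Real.pi / 2 * Complex.I) / 2) *
      hankel2 ν (Complex.log ζ - Real.pi / 2 * Complex.I))

lemma norm_le_norm_one_add {ζ : ℂ} (hζ : 0 ≤ ζ.re) : ‖ζ‖ ≤ ‖1 + ζ‖ ∧ 1 ≤ ‖1 + ζ‖ := by
  constructor
  · rw [← sq_le_sq₀ (norm_nonneg _) (norm_nonneg _), ← Complex.normSq_eq_norm_sq,
      ← Complex.normSq_eq_norm_sq, Complex.normSq_apply, Complex.normSq_apply]
    simp only [Complex.add_re, Complex.one_re, Complex.add_im, Complex.one_im]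
    nlinarith
  · calc (1 : ℝ) ≤ |(1 + ζ).re| := by
          rw [Complex.add_re, Complex.one_re, abs_of_nonneg (by linarith)]; linarith
      _ ≤ _ := Complex.abs_re_le_norm _

lemma mem_slitPlane_of_re_nonneg {ζ : ℂ} (hζ : 0 ≤ ζ.re) (h0 : ζ ≠ 0) : ζ ∈ Complex.slitPlane := by
  rw [Complex.mem_slitPlane_iff]
  by_contra! h
  exact h0 (Complex.ext (le_antisymm h.1 hζ) h.2)

lemma norm_exp_half_log_sub {ζ : ℂ} (h0 : ζ ≠ 0) :
    ‖Complex.exp ((Complex.log ζ - Real.pi / 2 * Complex.I) / 2)‖ = √‖ζ‖ := by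
  rw [Complex.norm_exp]
  have : ((Complex.log ζ - Real.pi / 2 * Complex.I) / 2).re = Real.log ‖ζ‖ / 2 := by
    simp [Complex.log_re]
  rw [this, Real.exp_half, Real.exp_log (norm_pos_iff.mpr h0)]

lemma exists_norm_scaledHankel_le {ν : ℝ} {m : ℕ} (hm : |ν| ≤ m) : ∃ C > 0, ∃ B > 0, ∀ ζ : ℂ,
    0 ≤ ζ.re → ζ ≠ 0 → ‖scaledHankel ν m ζ‖ ≤ C * √‖ζ‖ * Real.exp (B * ‖ζ‖) := by
  obtain ⟨C, hC, A, hA, h⟩ := exists_norm_hankel2_le ν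
  refine ⟨C, hC, 1 + |ν| + A, by positivity, fun ζ hζ h0 => ?_⟩
  have hn : 0 < ‖ζ‖ := norm_pos_iff.mpr h0
  obtain ⟨h1, h2⟩ := norm_le_norm_one_add hζ
  have hw := h (Complex.log ζ - Real.pi / 2 * Complex.I)
  have hre : (Complex.log ζ - Real.pi / 2 * Complex.I).re = Real.log ‖ζ‖ := by
    simp [Complex.log_re]
  rw [hre, Real.exp_log hn] at hw
  have h3 : ‖(ζ / (1 + ζ)) ^ m‖ * Real.exp (|ν| * |Real.log ‖ζ‖|) ≤ Real.exp (|ν| * ‖ζ‖) := by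
    rw [norm_pow, norm_div]
    rcases le_total 1 ‖ζ‖ with h4 | h4
    · have h5 : (‖ζ‖ / ‖1 + ζ‖) ^ m ≤ 1 :=
        pow_le_one₀ (by positivity) (div_le_one_of_le₀ h1 (by positivity))
      have h6 : |Real.log ‖ζ‖| ≤ ‖ζ‖ := by
        rw [abs_of_nonneg (Real.log_nonneg h4)]
        exact Real.log_le_self hn.le
      calc _ ≤ 1 * Real.exp (|ν| * ‖ζ‖) := by gcongr
        _ = _ := one_mul _
    · have h5 : (‖ζ‖ / ‖1 + ζ‖) ^ m ≤ Real.exp (m * Real.log ‖ζ‖) := by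
        rw [Real.exp_nat_mul, Real.exp_log hn]
        gcongr
        exact div_le_self hn.le h2
      have hl := Real.log_nonpos hn.le h4
      rw [abs_of_nonpos hl]
      calc _ ≤ Real.exp (m * Real.log ‖ζ‖) * Real.exp (|ν| * -Real.log ‖ζ‖) := by gcongr
        _ = Real.exp ((m - |ν|) * Real.log ‖ζ‖) := by rw [← Real.exp_add]; ring_nf
        _ ≤ 1 := Real.exp_le_one_iff.mpr
          (mul_nonpos_of_nonneg_of_nonpos (by linarith) hl)
        _ ≤ _ := Real.one_le_exp (by positivity)
  have h4 : ‖Complex.exp ζ‖ ≤ Real.exp ‖ζ‖ := by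
    rw [Complex.norm_exp]
    exact Real.exp_le_exp.mpr (Complex.re_le_norm ζ)
  rw [scaledHankel, norm_mul, norm_mul, norm_mul, norm_exp_half_log_sub h0]
  calc _ ≤ ‖(ζ / (1 + ζ)) ^ m‖ * Real.exp ‖ζ‖ *
        (√‖ζ‖ * (C * Real.exp (|ν| * |Real.log ‖ζ‖|) * Real.exp (A * ‖ζ‖))) := by gcongr
    _ = (‖(ζ / (1 + ζ)) ^ m‖ * Real.exp (|ν| * |Real.log ‖ζ‖|)) *
        (C * √‖ζ‖ * (Real.exp ‖ζ‖ * Real.exp (A * ‖ζ‖))) := by ring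
    _ ≤ Real.exp (|ν| * ‖ζ‖) * (C * √‖ζ‖ * (Real.exp ‖ζ‖ * Real.exp (A * ‖ζ‖))) := by gcongr
    _ = C * √‖ζ‖ * (Real.exp ‖ζ‖ * Real.exp (|ν| * ‖ζ‖) * Real.exp (A * ‖ζ‖)) := by ring
    _ = _ := by rw [← Real.exp_add, ← Real.exp_add]; ring_nf

lemma differentiableAt_scaledHankel (ν : ℝ) (m : ℕ) {ζ : ℂ} (hζ : 0 ≤ ζ.re) (h0 : ζ ≠ 0) :
    DifferentiableAt ℂ (scaledHankel ν m) ζ := by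
  have h1 : 1 + ζ ≠ 0 := norm_pos_iff.mp (one_pos.trans_le (norm_le_norm_one_add hζ).2)
  have hl : DifferentiableAt ℂ (fun ζ => Complex.log ζ - Real.pi / 2 * Complex.I) ζ :=
    (Complex.differentiableAt_log (mem_slitPlane_of_re_nonneg hζ h0)).sub_const _
  have hH : DifferentiableAt ℂ
      (fun ζ => hankel2 ν (Complex.log ζ - Real.pi / 2 * Complex.I)) ζ :=
    ((isBesselSolution_hankel2 ν).differentiable _).comp ζ hl
  have hq : DifferentiableAt ℂ (fun ζ : ℂ => ζ / (1 + ζ)) ζ :=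
    differentiableAt_id.div (by fun_prop) h1
  exact ((hq.pow m).mul Complex.differentiableAt_exp).mul ((hl.div_const 2).cexp.mul hH)

lemma continuousOn_scaledHankel {ν : ℝ} {m : ℕ} (hm : |ν| ≤ m) (hm0 : m ≠ 0) :
    ContinuousOn (scaledHankel ν m) {ζ | 0 ≤ ζ.re} := by
  intro ζ hζ
  rcases eq_or_ne ζ 0 with rfl | h0
  · obtain ⟨C, hC, B, hB, h⟩ := exists_norm_scaledHankel_le hm
    have hz : scaledHankel ν m 0 = 0 := by simp [scaledHankel, hm0]
    rw [ContinuousWithinAt, hz]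
    refine squeeze_zero_norm' (a := fun ζ : ℂ => C * √‖ζ‖ * Real.exp (B * ‖ζ‖)) ?_ ?_
    · filter_upwards [self_mem_nhdsWithin] with ζ hζ
      rcases eq_or_ne ζ 0 with rfl | h0
      · simp [hz]
      · exact h ζ hζ h0
    · have : Continuous fun ζ : ℂ => C * √‖ζ‖ * Real.exp (B * ‖ζ‖) := by fun_prop
      exact (this.tendsto' 0 0 (by simp)).mono_left nhdsWithin_le_nhds
  · exact (differentiableAt_scaledHankel ν m hζ h0).continuousAt.continuousWithinAt

lemma log_ofReal_mul_I_sub {y : ℝ} (hy : 0 < y) :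
    Complex.log (y * Complex.I) - Real.pi / 2 * Complex.I =
      (Real.log y : ℂ) + ((0 : ℤ) : ℂ) * Real.pi * Complex.I ∧
    Complex.log ((-y : ℝ) * Complex.I) - Real.pi / 2 * Complex.I =
      (Real.log y : ℂ) + ((-1 : ℤ) : ℂ) * Real.pi * Complex.I := by
  constructor
  · rw [Complex.log_ofReal_mul hy Complex.I_ne_zero, Complex.log_I]
    push_cast; ring
  · rw [show ((-y : ℝ) : ℂ) * Complex.I = y * -Complex.I by push_cast; ring,
      Complex.log_ofReal_mul hy (neg_ne_zero.mpr Complex.I_ne_zero), Complex.log_neg_I]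
    push_cast; ring

lemma exists_norm_scaledHankel_mul_I_le {ν : ℝ} {m : ℕ} (hm : |ν| ≤ m) (hm0 : m ≠ 0) :
    ∃ C, ∀ y : ℝ, ‖scaledHankel ν m (y * Complex.I)‖ ≤ C := by
  have hcont : ContinuousOn (fun y : ℝ => scaledHankel ν m (y * Complex.I)) (Set.Icc (-1) 1) :=
    (continuousOn_scaledHankel hm hm0).comp (by fun_prop) fun y _ => by simp
  obtain ⟨C₀, h₀⟩ := isCompact_Icc.exists_bound_of_continuousOn hcont
  obtain ⟨C₁, h₁⟩ := (isBesselSolution_hankel2 ν).exists_norm_le_of_im_eq 0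
  obtain ⟨C₂, h₂⟩ := (isBesselSolution_hankel2 ν).exists_norm_le_of_im_eq (-1)
  have key : ∀ (y s : ℝ) (k : ℤ), 1 ≤ y → |s| = y →
      Complex.log (s * Complex.I) - Real.pi / 2 * Complex.I =
        (Real.log y : ℂ) + (k : ℂ) * Real.pi * Complex.I →
      ‖scaledHankel ν m (s * Complex.I)‖ ≤ ‖Complex.exp ((Real.log y : ℝ) / 2) *
        hankel2 ν ((Real.log y : ℝ) + k * Real.pi * Complex.I)‖ := fun y s k hy hs hlog => by
    have hn : ‖(s : ℂ) * Complex.I‖ = y := by simp [hs]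
    have hs0 : (s : ℂ) * Complex.I ≠ 0 := by
      rw [← norm_pos_iff, hn]; linarith
    have hre : 0 ≤ ((s : ℂ) * Complex.I).re := by simp
    obtain ⟨h1, h2⟩ := norm_le_norm_one_add hre
    have hp : ‖((s : ℂ) * Complex.I / (1 + s * Complex.I)) ^ m‖ ≤ 1 := by
      rw [norm_pow, norm_div]
      exact pow_le_one₀ (by positivity) (div_le_one_of_le₀ h1 (by positivity))
    have he : ‖Complex.exp ((Real.log y : ℝ) / 2)‖ = √y := by
      rw [Complex.norm_exp, show (((Real.log y : ℝ) : ℂ) / 2).re = Real.log y / 2 by simp,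
        Real.exp_half, Real.exp_log (by linarith)]
    rw [scaledHankel, norm_mul, norm_mul, norm_mul, norm_exp_half_log_sub hs0,
      Complex.norm_exp_ofReal_mul_I, mul_one, hn, hlog, norm_mul, he]
    exact mul_le_of_le_one_left (by positivity) hp
  refine ⟨max C₀ (max C₁ C₂), fun y => ?_⟩
  rcases le_or_gt |y| 1 with hy | hy
  · exact (h₀ y (abs_le.mp hy)).trans (le_max_left _ _)
  · refine le_trans ?_ (le_max_right _ _)
    have hl := Real.log_nonneg hy.le
    rcases le_total 0 y with hy0 | hy0
    · refine le_trans ?_ (le_max_left _ _)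
      rw [abs_of_nonneg hy0] at hy hl
      exact (key y y 0 hy.le (abs_of_nonneg hy0) (log_ofReal_mul_I_sub (by linarith)).1).trans
        (h₁ _ hl)
    · refine le_trans ?_ (le_max_right _ _)
      rw [abs_of_nonpos hy0] at hy hl
      have := (log_ofReal_mul_I_sub (y := -y) (by linarith)).2
      rw [neg_neg] at this
      exact (key (-y) y (-1) hy.le (abs_of_nonpos hy0) this).trans (h₂ _ hl)

lemma exists_norm_scaledHankel_le_const {ν : ℝ} {m : ℕ} (hm : |ν| ≤ m) (hm0 : m ≠ 0) :
    ∃ C, ∀ ζ : ℂ, 0 ≤ ζ.re → ‖scaledHankel ν m ζ‖ ≤ C := by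
  obtain ⟨C, hC⟩ := exists_norm_scaledHankel_mul_I_le hm hm0
  refine ⟨C, fun ζ hζ => PhragmenLindelof.right_half_plane_of_bounded_on_real ?_ ?_ ?_ hC hζ⟩
  · refine ⟨fun ζ hζ => (differentiableAt_scaledHankel ν m (le_of_lt hζ) ?_).differentiableWithinAt,
      ?_⟩
    · rintro rfl
      simp at hζ
    · rw [Complex.closure_setOfPred_lt_re]
      exact continuousOn_scaledHankel hm hm0
  · obtain ⟨C', hC', B, hB, h⟩ := exists_norm_scaledHankel_le hm
    refine ⟨1, by norm_num, B + 1, Asymptotics.IsBigO.of_bound C' ?_⟩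
    refine eventually_inf_principal.mpr (.of_forall fun ζ hζ => ?_)
    have hζ' : 0 < ζ.re := hζ
    refine (h ζ hζ'.le (by rintro rfl; simp at hζ')).trans ?_
    have h1 : √‖ζ‖ ≤ Real.exp ‖ζ‖ := by
      refine Real.sqrt_le_iff.mpr ⟨(Real.exp_pos _).le, ?_⟩
      nlinarith [Real.add_one_le_exp ‖ζ‖, norm_nonneg ζ]
    rw [Real.rpow_one, Real.norm_of_nonneg (Real.exp_pos _).le, add_mul, one_mul, Real.exp_add]
    calc C' * √‖ζ‖ * Real.exp (B * ‖ζ‖) ≤ C' * Real.exp ‖ζ‖ * Real.exp (B * ‖ζ‖) := by gcongr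
      _ = _ := by ring
  · obtain ⟨C', h⟩ := exists_norm_hankel2_le_on_ray ν
    refine ⟨C', ?_⟩
    rw [eventually_map]
    filter_upwards [Real.tendsto_log_atTop.eventually h, eventually_gt_atTop 0] with x hx hx0
    have hre : 0 ≤ (x : ℂ).re := by simpa using hx0.le
    obtain ⟨h1, h2⟩ := norm_le_norm_one_add hre
    have hp : ‖((x : ℂ) / (1 + x)) ^ m‖ ≤ 1 := by
      rw [norm_pow, norm_div]
      exact pow_le_one₀ (by positivity) (div_le_one_of_le₀ h1 (by positivity))
    have hxn : (x : ℂ) ≠ 0 := by exact_mod_cast hx0.ne'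
    have he : ‖Complex.exp ((Real.log x : ℝ) / 2)‖ = √‖(x : ℂ)‖ := by
      rw [Complex.norm_exp, show (((Real.log x : ℝ) : ℂ) / 2).re = Real.log x / 2 by simp,
        Real.exp_half, Real.exp_log hx0, Complex.norm_of_nonneg hx0.le]
    rw [norm_mul, he, Real.exp_log hx0] at hx
    rw [scaledHankel, norm_mul, norm_mul, norm_mul, norm_exp_half_log_sub hxn,
      ← Complex.ofReal_log hx0.le, Complex.norm_exp, Complex.ofReal_re]
    calc _ ≤ 1 * Real.exp x * (C' * Real.exp (-x)) := by gcongr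
      _ = C' * (Real.exp x * Real.exp (-x)) := by ring
      _ = C' := by rw [← Real.exp_add, add_neg_cancel, Real.exp_zero, mul_one]

/-- `|√z H_ν(z)| ≤ C e^{Im z}` on the closed sheet `-π ≤ arg z ≤ 0`, away from `z = 0`. -/
theorem exists_norm_sqrt_mul_hankel2_le (ν : ℝ) : ∃ C, ∀ w : ℂ, 0 ≤ w.re →
    w.im ∈ Set.Icc (-Real.pi) 0 →
    ‖Complex.exp (w / 2) * hankel2 ν w‖ ≤ C * Real.exp (Real.exp w.re * Real.sin w.im) := by
  obtain ⟨m₀, hm₀⟩ := exists_nat_ge |ν|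
  have hm : |ν| ≤ (m₀ + 1 : ℕ) := hm₀.trans (by push_cast; linarith)
  obtain ⟨C, hC⟩ := exists_norm_scaledHankel_le_const hm (Nat.succ_ne_zero m₀)
  refine ⟨2 ^ (m₀ + 1) * C, fun w hw hwi => ?_⟩
  set ζ := Complex.exp (w + Real.pi / 2 * Complex.I) with hζ
  have him : (w + Real.pi / 2 * Complex.I).im = w.im + Real.pi / 2 := by simp
  have hre : (w + Real.pi / 2 * Complex.I).re = w.re := by simp
  have hpi := Real.pi_pos
  have hlog : Complex.log ζ - Real.pi / 2 * Complex.I = w := by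
    rw [hζ, Complex.log_exp (by rw [him]; linarith [hwi.1]) (by rw [him]; linarith [hwi.2])]
    ring
  have hn : ‖ζ‖ = Real.exp w.re := by rw [hζ, Complex.norm_exp, hre]
  have hζre : ζ.re = -(Real.exp w.re * Real.sin w.im) := by
    rw [hζ, Complex.exp_re, hre, him, Real.cos_add_pi_div_two]
    ring
  have hsin : Real.sin w.im ≤ 0 := Real.sin_nonpos_of_nonpos_of_neg_pi_le hwi.2 hwi.1
  have hζ0 : 0 ≤ ζ.re := by
    rw [hζre, neg_nonneg]
    exact mul_nonpos_of_nonneg_of_nonpos (Real.exp_pos _).le hsin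
  have hone : 1 ≤ ‖ζ‖ := by rw [hn]; exact Real.one_le_exp hw
  have h2 : (1 / 2 : ℝ) ≤ ‖ζ / (1 + ζ)‖ := by
    have h3 : ‖1 + ζ‖ ≤ 1 + ‖ζ‖ := by simpa using norm_add_le 1 ζ
    have h4 := (norm_le_norm_one_add hζ0).2
    rw [norm_div, le_div_iff₀ (by linarith)]
    linarith
  have h := hC ζ hζ0
  rw [scaledHankel, hlog, norm_mul, norm_mul, norm_pow, Complex.norm_exp ζ, hζre] at h
  set U := ‖Complex.exp (w / 2) * hankel2 ν w‖
  set s := Real.exp w.re * Real.sin w.im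
  have h5 : (1 / 2 : ℝ) ^ (m₀ + 1) * Real.exp (-s) * U ≤ C := le_trans (by gcongr) h
  calc U = 2 ^ (m₀ + 1) * ((1 / 2 : ℝ) ^ (m₀ + 1) * Real.exp (-s) * U) * Real.exp s := by
        have e1 : (2 : ℝ) ^ (m₀ + 1) * (1 / 2) ^ (m₀ + 1) = 1 := by
          rw [← mul_pow]; norm_num
        have e2 : Real.exp (-s) * Real.exp s = 1 := by
          rw [← Real.exp_add, neg_add_cancel, Real.exp_zero]
        linear_combination (-U) * e1 - (2 : ℝ) ^ (m₀ + 1) * (1 / 2) ^ (m₀ + 1) * U * e2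
    _ ≤ 2 ^ (m₀ + 1) * C * Real.exp s := by gcongr

/-! ### The wave function -/

lemma norm_hankel2_add_two_pi_mul {N M : ℕ} (hN : N ≠ 0) (w : ℂ) :
    ‖hankel2 ((M / (2 * N) : ℝ) : ℂ) (w + (2 * N : ℤ) * Real.pi * Complex.I)‖ =
      ‖hankel2 ((M / (2 * N) : ℝ) : ℂ) w‖ := by
  set ν : ℝ := M / (2 * N) with hν
  have hM : (ν : ℂ) * (((2 * N : ℤ) : ℂ) * Real.pi * Complex.I) = M * (Real.pi * Complex.I) := by
    have : (N : ℂ) ≠ 0 := by exact_mod_cast hN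
    rw [hν]
    push_cast
    field_simp
  have hu : Complex.exp (ν * (((2 * N : ℤ) : ℂ) * Real.pi * Complex.I)) = (-1) ^ M := by
    rw [hM, Complex.exp_nat_mul, Complex.exp_pi_mul_I]
  have hu' : Complex.exp (((-ν : ℝ) : ℂ) * (((2 * N : ℤ) : ℂ) * Real.pi * Complex.I)) =
      (-1) ^ M := by
    rw [Complex.ofReal_neg, neg_mul, Complex.exp_neg, hu, ← inv_pow, inv_neg, inv_one]
  rw [hankel2_eq, hankel2_eq, besselJ_add_int_mul_pi, besselJ_add_int_mul_pi, hu, hu',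
    mul_left_comm, mul_left_comm _ ((-1) ^ M : ℂ), ← mul_add, norm_mul, norm_pow, norm_neg,
    norm_one, one_pow, one_mul]

lemma exists_hankel2_ne_zero {ν : ℝ} (hν : Real.sin (Real.pi * ν) ≠ 0) :
    ∃ w, hankel2 ν w ≠ 0 := by
  by_contra! h
  have hs : Complex.sin (Real.pi * ν) ≠ 0 := by exact_mod_cast hν
  have hD : -Complex.I * Complex.sin (Real.pi * ν) ≠ 0 :=
    mul_ne_zero (neg_ne_zero.mpr Complex.I_ne_zero) hs
  have h1 : ∀ w, besselJ ((-ν : ℝ) : ℂ) w = Complex.exp (Complex.I * Real.pi * ν) * besselJ ν w :=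
    fun w => by
    have := h w
    rw [hankel2, div_eq_zero_iff, or_iff_left hD, sub_eq_zero] at this
    rw [Complex.ofReal_neg]
    exact this
  have hp : Complex.exp (ν * (((1 : ℤ) : ℂ) * Real.pi * Complex.I)) =
      Complex.exp (Complex.I * Real.pi * ν) := by congr 1; push_cast; ring
  -- A half-turn multiplies the two sides by different factors, so that `J_ν` would vanish.
  have h2 : ∀ w, besselJ ν w = 0 := fun w => by
    have h3 := h1 (w + (1 : ℤ) * Real.pi * Complex.I)
    rw [besselJ_add_int_mul_pi, besselJ_add_int_mul_pi, h1 w, hp, Complex.ofReal_neg, neg_mul,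
      Complex.exp_neg, hp] at h3
    by_contra hJ
    apply hs
    have hsin : Complex.sin (Real.pi * ν) = ((Complex.exp (Complex.I * Real.pi * ν))⁻¹ -
        Complex.exp (Complex.I * Real.pi * ν)) * Complex.I / 2 := by
      rw [Complex.sin, ← Complex.exp_neg]
      ring_nf
    have he := Complex.exp_ne_zero (Complex.I * Real.pi * ν)
    set u := Complex.exp (Complex.I * Real.pi * ν)
    rw [← mul_assoc, inv_mul_cancel₀ he, one_mul, ← mul_assoc] at h3
    have h4 : u * u = 1 := mul_right_cancel₀ hJ (by rw [one_mul]; exact h3.symm)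
    rw [hsin, inv_eq_of_mul_eq_one_right h4]
    ring
  have hev := (tendsto_besselI ν).eventually_const_lt
    (inv_pos.mpr (by positivity : (0 : ℝ) < √(2 * Real.pi)))
  obtain ⟨x, hx, hx0⟩ := (hev.and (eventually_gt_atTop 0)).exists
  have h5 := h2 (Real.log x - Real.pi / 2 * Complex.I)
  rw [besselJ_ray ν hx0, mul_eq_zero, or_iff_right (Complex.exp_ne_zero _)] at h5
  rw [Complex.ofReal_eq_zero.mp h5, mul_zero] at hx
  exact lt_irrefl _ hx

lemma exp_two_mul_shift (N : ℕ) {κ : ℝ} (hκ : 0 < κ) (w : ℂ) :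
    Complex.exp (2 * (Real.log κ + N * Real.pi * Complex.I + w)) =
      κ ^ 2 * Complex.exp w ^ 2 := by
  rw [show (2 : ℂ) * (Real.log κ + N * Real.pi * Complex.I + w) =
    (2 : ℕ) * (Real.log κ : ℂ) + (2 : ℕ) * w + (N : ℤ) * (2 * Real.pi * Complex.I) by
      push_cast; ring,
    Complex.exp_add, Complex.exp_int_mul_two_pi_mul_I, mul_one, Complex.exp_add,
    Complex.exp_nat_mul, Complex.exp_nat_mul, ← Complex.ofReal_exp, Real.exp_log hκ]

lemma solvesSchrodinger_waveFunction (N : ℕ) {ν κ ℓ γ : ℝ} (hκ : 0 < κ)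
    (hνγ : ℓ * (ℓ + 1) + γ = ν ^ 2 - 1 / 4) :
    SolvesSchrodinger ℓ γ (κ ^ 2) (waveFunction N ν κ) := by
  set b : ℂ := Real.log κ + N * Real.pi * Complex.I with hb
  have hH := isBesselSolution_hankel2 ν
  have hsh : ∀ w : ℂ, HasDerivAt (fun w => b + w) 1 w := fun w => (hasDerivAt_id w).const_add b
  have h0 : ∀ w : ℂ, HasDerivAt (fun w => hankel2 ν (b + w)) (deriv (hankel2 ν) (b + w)) w :=
    fun w => (((hH.hasDerivAt (b + w)).comp w (hsh w))).congr_deriv (mul_one _)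
  have h1 : ∀ w : ℂ, HasDerivAt (fun w => deriv (hankel2 ν) (b + w))
      ((ν ^ 2 - κ ^ 2 * Complex.exp w ^ 2) * hankel2 ν (b + w)) w := fun w => by
    refine (((hH.hasDerivAt_deriv (b + w)).comp w (hsh w))).congr_deriv ?_
    rw [mul_one, hb, exp_two_mul_shift N hκ]
  have he : ∀ (a w : ℂ), HasDerivAt (fun w => Complex.exp (a * w)) (a * Complex.exp (a * w)) w :=
    fun a w => by
    have := ((hasDerivAt_id w).const_mul a).cexp
    simpa [mul_comm] using this
  have hψ : waveFunction N ν κ = fun w => Complex.exp (1 / 2 * w) * hankel2 ν (b + w) := by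
    funext w
    rw [waveFunction, div_eq_inv_mul, one_div]
  have hd : ∀ w : ℂ, HasDerivAt (waveFunction N ν κ) (Complex.exp (1 / 2 * w) *
      (hankel2 ν (b + w) / 2 + deriv (hankel2 ν) (b + w))) w := fun w => by
    rw [hψ]
    refine ((he (1 / 2) w).mul (h0 w)).congr_deriv ?_
    ring
  have hr : rDeriv (waveFunction N ν κ) = fun w => Complex.exp (-(1 / 2) * w) *
      (hankel2 ν (b + w) / 2 + deriv (hankel2 ν) (b + w)) := by
    funext w
    rw [rDeriv, (hd w).deriv, show (1 / 2 : ℂ) * w = w + -(1 / 2) * w by ring, Complex.exp_add]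
    field_simp
  have hr2 : ∀ w : ℂ, HasDerivAt (rDeriv (waveFunction N ν κ)) (Complex.exp (-(1 / 2) * w) *
      ((ν ^ 2 - 1 / 4 - κ ^ 2 * Complex.exp w ^ 2) * hankel2 ν (b + w))) w := fun w => by
    rw [hr]
    refine ((he (-(1 / 2)) w).mul (((h0 w).div_const 2).add (h1 w))).congr_deriv ?_
    simp only [Pi.add_apply]
    ring
  refine ⟨fun w => (hd w).differentiableAt, fun w => ?_⟩
  have hu : Complex.exp w = Complex.exp (1 / 2 * w) ^ 2 := by
    rw [← Complex.exp_nat_mul]; push_cast; ring_nf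
  have hne := Complex.exp_ne_zero (1 / 2 * w)
  have hc : (ℓ : ℂ) * (ℓ + 1) + γ = ν ^ 2 - 1 / 4 := by
    have := congrArg (fun x : ℝ => (x : ℂ)) hνγ
    push_cast at this
    exact this
  rw [rDeriv, (hr2 w).deriv, hψ, neg_mul, Complex.exp_neg, hu]
  push_cast
  field_simp
  linear_combination (4 * hankel2 ν (b + w)) * hc

lemma continuous_waveFunction (N : ℕ) (ν κ : ℝ) : Continuous (waveFunction N ν κ) :=
  (by fun_prop : Continuous fun w : ℂ => Complex.exp (w / 2)).mul
    ((isBesselSolution_hankel2 ν).differentiable.continuous.comp (by fun_prop))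

/-- The wave function decays, with the same bound, on the two sheets on which the argument of
`κ r e^{iNπ}` is in `[-π, 0]` or in `[(2N-1)π, 2Nπ]`: the winding number `N` turns the one into
the other, and `2N ν = M` is an integer. -/
lemma exists_norm_waveFunction_le {N M : ℕ} (hN : N ≠ 0) {κ : ℝ} (hκ : 0 < κ) :
    ∃ C, 0 ≤ C ∧ ∀ w : ℂ, -Real.log κ ≤ w.re →
      (w.im + N * Real.pi ∈ Set.Icc (-Real.pi) 0 ∨ w.im - N * Real.pi ∈ Set.Icc (-Real.pi) 0) →
      ‖waveFunction N (M / (2 * N)) κ w‖ ≤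
        C * Real.exp (κ * Real.exp w.re * Real.sin (w.im + N * Real.pi)) := by
  set ν : ℝ := M / (2 * N) with hν
  obtain ⟨C, hC⟩ := exists_norm_sqrt_mul_hankel2_le ν
  have hC0 : 0 ≤ C := by
    have := (norm_nonneg _).trans (hC 0 (by simp) (by simp [Real.pi_pos.le]))
    simpa using this
  have key : ∀ v : ℂ, 0 ≤ v.re → v.im ∈ Set.Icc (-Real.pi) 0 →
      Real.exp (v.re / 2) * ‖hankel2 ν v‖ ≤ C * Real.exp (Real.exp v.re * Real.sin v.im) :=
    fun v hv hv' => by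
    have := hC v hv hv'
    rwa [norm_mul, Complex.norm_exp, show (v / 2).re = v.re / 2 by simp] at this
  refine ⟨Real.exp (-(Real.log κ / 2)) * C, by positivity, fun w hw him => ?_⟩
  set v : ℂ := Real.log κ + N * Real.pi * Complex.I + w with hv
  have hvre : v.re = Real.log κ + w.re := by simp [hv]
  have hvim : v.im = w.im + N * Real.pi := by simp [hv]; ring
  have hψ : ‖waveFunction N ν κ w‖ =
      Real.exp (-(Real.log κ / 2)) * (Real.exp (v.re / 2) * ‖hankel2 ν v‖) := by
    rw [waveFunction, norm_mul, Complex.norm_exp, ← mul_assoc, ← Real.exp_add,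
      show (w / 2).re = w.re / 2 by simp, hvre]
    congr 2
    ring
  rw [hψ, mul_assoc]
  refine mul_le_mul_of_nonneg_left ?_ (Real.exp_pos _).le
  have hexp : κ * Real.exp w.re = Real.exp v.re := by rw [hvre, Real.exp_add, Real.exp_log hκ]
  rw [hexp]
  rcases him with h | h
  · rw [← hvim] at h ⊢
    exact key v (by rw [hvre]; linarith) h
  · have hsheet := norm_hankel2_add_two_pi_mul (N := N) (M := M) hN
      (v - (2 * N : ℤ) * Real.pi * Complex.I)
    rw [sub_add_cancel, ← hν] at hsheet
    have hre : (v - (2 * N : ℤ) * Real.pi * Complex.I).re = v.re := by simp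
    have him : (v - (2 * N : ℤ) * Real.pi * Complex.I).im = v.im - N * (2 * Real.pi) := by
      simp; ring
    have := key (v - (2 * N : ℤ) * Real.pi * Complex.I) (by rw [hre, hvre]; linarith) (by
      rw [him, hvim]
      convert h using 1
      ring)
    rw [hre, him, ← hsheet, Real.sin_sub_nat_mul_two_pi, hvim] at this
    exact this

/-! ### Square integrability along symmetric contours -/

lemma contDiff_proj {c : ℝ → ℂ} (hc : ContDiff ℝ 1 c) : ContDiff ℝ 1 (proj c) := hc.cexp

lemma continuous_deriv_proj {c : ℝ → ℂ} (hc : ContDiff ℝ 1 c) : Continuous (deriv (proj c)) :=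
  (contDiff_proj hc).continuous_deriv le_rfl

lemma hasDerivAt_proj {c : ℝ → ℂ} (hc : ContDiff ℝ 1 c) (s : ℝ) :
    HasDerivAt (proj c) (Complex.exp (c s) * deriv c s) s :=
  ((hc.differentiable one_ne_zero s).hasDerivAt).cexp

lemma memLp_arcLength {c : ℝ → ℂ} (hc : ContDiff ℝ 1 c) {ψ : ℂ → ℂ} (hψ : Continuous ψ)
    (h : Integrable fun s => ‖deriv (proj c) s‖ * ‖ψ (c s)‖ ^ 2) :
    MemLp (fun s => ψ (c s)) 2 (arcLength c) := by
  have hmeas : AEStronglyMeasurable (fun s => ψ (c s)) (arcLength c) :=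
    (hψ.comp hc.continuous).aestronglyMeasurable
  rw [memLp_two_iff_integrable_sq_norm hmeas]
  have hm : Measurable fun s => ‖deriv (proj c) s‖₊ :=
    (continuous_deriv_proj hc).nnnorm.measurable
  exact (integrable_withDensity_iff_integrable_smul hm).mpr h

lemma norm_deriv_proj_neg {c : ℝ → ℂ}
    (hsymm : ∀ s, c (-s) = (starRingEnd ℂ) (c s) - Real.pi * Complex.I) (s : ℝ) :
    ‖deriv (proj c) (-s)‖ = ‖deriv (proj c) s‖ := by
  have h : (fun s => proj c (-s)) = fun s => -star (proj c s) := by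
    funext s
    rw [proj, proj, hsymm, Complex.exp_sub, Complex.exp_pi_mul_I, Complex.exp_conj]
    simp [div_neg]
  have h1 := congrFun (congrArg deriv h) s
  rw [deriv_comp_neg, deriv.fun_neg, deriv.star, neg_inj] at h1
  rw [h1, norm_star]

/-- On a symmetric contour only the right end matters for the square integrability. -/
lemma memLp_waveFunction_of_symm {N M : ℕ} (hN : N ≠ 0) {κ : ℝ} (hκ : 0 < κ) {c : ℝ → ℂ}
    (hc : ContDiff ℝ 1 c)
    (hsymm : ∀ s, c (-s) = (starRingEnd ℂ) (c s) - Real.pi * Complex.I)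
    (hend : ∀ᶠ s in atTop, -Real.log κ ≤ (c s).re ∧
      (c s).im - N * Real.pi ∈ Set.Icc (-Real.pi) 0)
    (hint : IntegrableAtFilter (fun s => ‖deriv (proj c) s‖ *
      Real.exp (2 * κ * Real.exp (c s).re * Real.sin ((c s).im + N * Real.pi))) atTop) :
    MemLp (fun s => waveFunction N (M / (2 * N)) κ (c s)) 2 (arcLength c) := by
  obtain ⟨C, hC0, hC⟩ := exists_norm_waveFunction_le (M := M) hN hκ
  set ν : ℝ := M / (2 * N)
  have hψ := continuous_waveFunction N ν κ
  refine memLp_arcLength hc hψ ?_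
  set F : ℝ → ℝ := fun s => ‖deriv (proj c) s‖ * ‖waveFunction N ν κ (c s)‖ ^ 2 with hF
  set b : ℝ → ℝ := fun s => ‖deriv (proj c) s‖ *
      Real.exp (2 * κ * Real.exp (c s).re * Real.sin ((c s).im + N * Real.pi)) with hb
  have hFc : Continuous F :=
    (continuous_deriv_proj hc).norm.mul ((hψ.comp hc.continuous).norm.pow 2)
  have hsq : ∀ (w : ℂ) (x : ℝ), ‖waveFunction N ν κ w‖ ≤ C * Real.exp x →
      ‖waveFunction N ν κ w‖ ^ 2 ≤ C ^ 2 * Real.exp (2 * x) := fun w x h => by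
    calc _ ≤ (C * Real.exp x) ^ 2 := by gcongr
      _ = _ := by rw [mul_pow, ← Real.exp_nat_mul]; norm_num
  obtain ⟨T₁, hT₁⟩ := eventually_atTop.mp hend
  obtain ⟨T₂, hT₂⟩ := integrableAtFilter_atTop_iff.mp hint
  set T := max T₁ T₂
  have hbT : IntegrableOn (fun s => C ^ 2 * b s) (Set.Ioi T) :=
    (hT₂.mono_set fun s hs => (le_max_right T₁ T₂).trans (le_of_lt hs)).const_mul _
  have hR : ∀ s ∈ Set.Ioi T, F s ≤ C ^ 2 * b s := fun s hs => by
    obtain ⟨h1, h2⟩ := hT₁ s ((le_max_left T₁ T₂).trans (le_of_lt hs))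
    have h3 := hsq _ _ (hC (c s) h1 (.inr h2))
    calc F s ≤ ‖deriv (proj c) s‖ * (C ^ 2 * Real.exp (2 * (κ * Real.exp (c s).re *
          Real.sin ((c s).im + N * Real.pi)))) := mul_le_mul_of_nonneg_left h3 (norm_nonneg _)
      _ = C ^ 2 * b s := by rw [hb]; ring_nf
  have hL : ∀ s ∈ Set.Ioi T, F (-s) ≤ C ^ 2 * b s := fun s hs => by
    obtain ⟨h1, h2⟩ := hT₁ s ((le_max_left T₁ T₂).trans (le_of_lt hs))
    have hre : (c (-s)).re = (c s).re := by rw [hsymm]; simp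
    have him : (c (-s)).im = -(c s).im - Real.pi := by rw [hsymm]; simp
    have hsin : Real.sin ((c (-s)).im + N * Real.pi) = Real.sin ((c s).im + N * Real.pi) := by
      rw [him, show -(c s).im - Real.pi + N * Real.pi =
        N * (2 * Real.pi) - ((c s).im + N * Real.pi + Real.pi) by ring,
        Real.sin_nat_mul_two_pi_sub, Real.sin_add_pi, neg_neg]
    have h4 : (c (-s)).im + N * Real.pi ∈ Set.Icc (-Real.pi) 0 := by
      rw [him]
      constructor <;> linarith [h2.1, h2.2]
    have h3 := hsq _ _ (hC (c (-s)) (by rw [hre]; exact h1) (.inl h4))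
    rw [hre, hsin] at h3
    calc F (-s) = ‖deriv (proj c) s‖ * ‖waveFunction N ν κ (c (-s))‖ ^ 2 := by
          rw [hF]; simp only; rw [norm_deriv_proj_neg hsymm]
      _ ≤ ‖deriv (proj c) s‖ * (C ^ 2 * Real.exp (2 * (κ * Real.exp (c s).re *
          Real.sin ((c s).im + N * Real.pi)))) := by gcongr
      _ = C ^ 2 * b s := by rw [hb]; ring_nf
  have hFR : IntegrableOn F (Set.Ioi T) := by
    refine hbT.mono' hFc.aestronglyMeasurable ?_
    filter_upwards [ae_restrict_mem measurableSet_Ioi] with s hs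
    rw [Real.norm_of_nonneg (by positivity)]
    exact hR s hs
  have hFL : IntegrableOn F (Set.Iio (-T)) := by
    have hpre : (fun s : ℝ => -s) ⁻¹' Set.Iio (-T) = Set.Ioi T := by ext s; simp
    rw [← (Measure.measurePreserving_neg (volume : Measure ℝ)).integrableOn_comp_preimage
      (MeasurableEquiv.neg ℝ).measurableEmbedding, hpre]
    refine hbT.mono' (hFc.comp continuous_neg).aestronglyMeasurable ?_
    filter_upwards [ae_restrict_mem measurableSet_Ioi] with s hs
    rw [Function.comp_apply, Real.norm_of_nonneg (by positivity)]
    exact hL s hs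
  rw [integrable_iff_integrableAtFilter_atBot_atTop]
  exact ⟨⟨⟨_, Iio_mem_atBot _, hFL⟩, ⟨_, Ioi_mem_atTop _, hFR⟩⟩, hFc.locallyIntegrable⟩

/-- By analyticity, a solution that vanishes almost everywhere on a contour vanishes
identically. -/
lemma not_ae_eq_zero_arcLength {c : ℝ → ℂ} (hc : ContDiff ℝ 1 c) (h0 : deriv (proj c) 0 ≠ 0)
    {ψ : ℂ → ℂ} (hψ : Differentiable ℂ ψ) (hne : ∃ w, ψ w ≠ 0) :
    ¬ ((fun s => ψ (c s)) =ᵐ[arcLength c] 0) := by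
  intro h
  have hcont := continuous_deriv_proj hc
  have h1 : ∀ᵐ s, ‖deriv (proj c) s‖ₑ ≠ 0 → ψ (c s) = 0 :=
    (ae_withDensity_iff hcont.enorm.measurable).mp h
  set U : Set ℝ := {s | deriv (proj c) s ≠ 0} with hU
  have hUo : IsOpen U := isOpen_ne_fun hcont continuous_const
  have h2 : (fun s => ψ (c s)) =ᵐ[volume.restrict U] fun _ => 0 := by
    refine (ae_restrict_iff' hUo.measurableSet).mpr ?_
    filter_upwards [h1] with s hs hsU
    exact hs (enorm_ne_zero.mpr hsU)
  have h3 : Set.EqOn (fun s => ψ (c s)) (fun _ => 0) U :=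
    Measure.eqOn_open_of_ae_eq h2 hUo (hψ.continuous.comp hc.continuous).continuousOn
      continuousOn_const
  have hc' : deriv c 0 ≠ 0 := fun h => h0 (by rw [(hasDerivAt_proj hc 0).deriv, h, mul_zero])
  have hd := (hc.differentiable one_ne_zero 0).hasDerivAt
  have ht : Tendsto c (𝓝[≠] 0) (𝓝[≠] (c 0)) :=
    tendsto_nhdsWithin_iff.mpr ⟨hc.continuous.continuousAt.mono_left nhdsWithin_le_nhds,
      hd.eventually_ne hc'⟩
  have hz : ∀ᶠ s in 𝓝[≠] (0 : ℝ), ψ (c s) = 0 :=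
    nhdsWithin_le_nhds (eventually_of_mem (hUo.mem_nhds h0) fun s hs => h3 hs)
  have hfr : ∃ᶠ w in 𝓝[≠] (c 0), ψ w = 0 := ht.frequently hz.frequently
  obtain ⟨w, hw⟩ := hne
  have han := hψ.differentiableOn.analyticOnNhd isOpen_univ
  exact hw (han.eqOn_zero_of_preconnected_of_frequently_eq_zero
    isPreconnected_univ (Set.mem_univ _) hfr (Set.mem_univ w))

/-! ### Tobogganic contours -/

/-- Along an asymptotically linear end `|r'| ≤ 2 d|r|/ds` eventually, so that an exponentially
decaying function of `|r|` is integrable with respect to arc length. -/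
lemma integrableAtFilter_norm_deriv_proj_mul_exp {c : ℝ → ℂ} (hc : ContDiff ℝ 1 c) {θ k : ℝ}
    (hk : 0 < k) (hre : Tendsto (fun s => (c s).re) atTop atTop)
    (him : Tendsto (fun s => (c s).im) atTop (𝓝 θ))
    (htan : Tendsto (fun s => deriv (proj c) s / (‖deriv (proj c) s‖ : ℂ)) atTop
      (𝓝 (Complex.exp (θ * Complex.I)))) :
    IntegrableAtFilter (fun s => ‖deriv (proj c) s‖ * Real.exp (-(k * Real.exp (c s).re)))
      atTop := by
  set u : ℝ → ℂ := fun s => deriv (proj c) s / (‖deriv (proj c) s‖ : ℂ) *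
    Complex.exp (-((c s).im * Complex.I)) with hu
  have hu1 : Tendsto (fun s => (u s).re) atTop (𝓝 1) := by
    have h1 : Tendsto (fun s => Complex.exp (-((c s).im * Complex.I))) atTop
        (𝓝 (Complex.exp (-(θ * Complex.I)))) := by
      have hcont : Continuous fun x : ℝ => Complex.exp (-(x * Complex.I)) := by fun_prop
      exact (hcont.tendsto θ).comp him
    have h2 := htan.mul h1
    rw [← Complex.exp_add, add_neg_cancel, Complex.exp_zero] at h2
    exact (Complex.continuous_re.tendsto 1).comp h2
  have hc' : ∀ s, Real.exp (c s).re * (deriv c s).re = ‖deriv (proj c) s‖ * (u s).re :=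
    fun s => by
    have h1 : (Real.exp (c s).re : ℂ) * deriv c s = ‖deriv (proj c) s‖ * u s := by
      have h2 : (‖deriv (proj c) s‖ : ℂ) * (deriv (proj c) s / (‖deriv (proj c) s‖ : ℂ)) =
          deriv (proj c) s := by
        rcases eq_or_ne (deriv (proj c) s) 0 with h | h
        · simp [h]
        · rw [mul_div_cancel₀]
          exact_mod_cast norm_ne_zero_iff.mpr h
      rw [hu]
      simp only
      rw [← mul_assoc, h2, (hasDerivAt_proj hc s).deriv, Complex.exp_neg, Complex.ofReal_exp]
      nth_rewrite 2 [← Complex.re_add_im (c s)]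
      rw [Complex.exp_add]
      have := Complex.exp_ne_zero ((c s).im * Complex.I)
      field_simp
    have := congrArg Complex.re h1
    rwa [Complex.re_ofReal_mul, Complex.re_ofReal_mul] at this
  obtain ⟨T, hT⟩ := eventually_atTop.mp (hu1.eventually_const_lt (by norm_num : (1 / 2 : ℝ) < 1))
  have hd : ∀ s, HasDerivAt (fun s => -(2 / k) * Real.exp (-(k * Real.exp (c s).re)))
      (2 * (Real.exp (c s).re * (deriv c s).re) * Real.exp (-(k * Real.exp (c s).re))) s :=
    fun s => by
    have h1 : HasDerivAt (fun s => (c s).re) (deriv c s).re s :=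
      Complex.reCLM.hasFDerivAt.comp_hasDerivAt s
        (hc.differentiable one_ne_zero s).hasDerivAt
    refine (((h1.exp.const_mul k).neg.exp).const_mul (-(2 / k))).congr_deriv ?_
    simp only [Pi.neg_apply]
    field_simp
  have hlim : Tendsto (fun s => -(2 / k) * Real.exp (-(k * Real.exp (c s).re))) atTop (𝓝 0) := by
    have h1 : Tendsto (fun s => k * Real.exp (c s).re) atTop atTop :=
      (Real.tendsto_exp_atTop.comp hre).const_mul_atTop hk
    simpa using (Real.tendsto_exp_neg_atTop_nhds_zero.comp h1).const_mul (-(2 / k))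
  have hle : ∀ s, T ≤ s → ‖deriv (proj c) s‖ ≤ 2 * (Real.exp (c s).re * (deriv c s).re) :=
    fun s hs => by
    rw [hc']
    nlinarith [hT s hs, norm_nonneg (deriv (proj c) s)]
  have hI := integrableOn_Ioi_deriv_of_nonneg' (a := T) (fun s _ => hd s) (fun s hs =>
    mul_nonneg ((norm_nonneg _).trans (hle s (le_of_lt hs))) (Real.exp_pos _).le) hlim
  refine ⟨Set.Ioi T, Ioi_mem_atTop T, hI.mono' ?_ ?_⟩
  · have h1 := continuous_deriv_proj hc
    have h2 := hc.continuous
    exact (by fun_prop : Continuous fun s => ‖deriv (proj c) s‖ *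
      Real.exp (-(k * Real.exp (c s).re))).aestronglyMeasurable
  · filter_upwards [ae_restrict_mem measurableSet_Ioi] with s hs
    rw [Real.norm_of_nonneg (by positivity)]
    exact mul_le_mul_of_nonneg_right (hle s (le_of_lt hs)) (Real.exp_pos _).le

lemma continuous_norm_deriv_proj_mul_exp_sin {c : ℝ → ℂ} (hc : ContDiff ℝ 1 c) (N : ℕ) (κ : ℝ) :
    Continuous fun s => ‖deriv (proj c) s‖ *
      Real.exp (2 * κ * Real.exp (c s).re * Real.sin ((c s).im + N * Real.pi)) := by
  have h1 := continuous_deriv_proj hc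
  have h2 := hc.continuous
  fun_prop

lemma IsTobogganicContour.memLp_waveFunction {N M : ℕ} (hN : N ≠ 0) {κ : ℝ} (hκ : 0 < κ)
    {c : ℝ → ℂ} (h : IsTobogganicContour N c) :
    MemLp (fun s => waveFunction N (M / (2 * N)) κ (c s)) 2 (arcLength c) := by
  obtain ⟨θ, ⟨hθ1, hθ2⟩, hre, him, htan⟩ := h.ends
  push_cast at hθ1 hθ2
  have hsinθ : Real.sin (θ + N * Real.pi) < 0 := by
    rw [show θ + N * Real.pi = θ - N * Real.pi + N * (2 * Real.pi) by ring,
      Real.sin_add_nat_mul_two_pi]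
    exact Real.sin_neg_of_neg_of_neg_pi_lt (by linarith) (by linarith)
  set σ : ℝ := -Real.sin (θ + N * Real.pi) / 2 with hσ
  have hσ0 : 0 < σ := by rw [hσ]; linarith
  have hsin : Tendsto (fun s => Real.sin ((c s).im + N * Real.pi)) atTop
      (𝓝 (Real.sin (θ + N * Real.pi))) :=
    (Real.continuous_sin.tendsto _).comp (him.add_const _)
  have hev : ∀ᶠ s in atTop, Real.sin ((c s).im + N * Real.pi) < -σ :=
    hsin.eventually_lt_const (by rw [hσ]; linarith)
  refine memLp_waveFunction_of_symm hN hκ h.contDiff h.symm ?_ ?_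
  · filter_upwards [hre.eventually_ge_atTop (-Real.log κ), him.eventually_const_lt hθ1,
      him.eventually_lt_const hθ2] with s h1 h2 h3
    exact ⟨h1, by linarith, by linarith⟩
  · obtain ⟨T₁, hT₁⟩ := eventually_atTop.mp hev
    obtain ⟨T₂, hT₂⟩ := integrableAtFilter_atTop_iff.mp
      (integrableAtFilter_norm_deriv_proj_mul_exp h.contDiff (k := 2 * κ * σ) (by positivity)
        hre him htan)
    refine integrableAtFilter_atTop_iff.mpr ⟨max T₁ T₂, ?_⟩
    refine (hT₂.mono_set (Set.Ici_subset_Ici.mpr (le_max_right T₁ T₂))).mono' ?_ ?_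
    · exact (continuous_norm_deriv_proj_mul_exp_sin h.contDiff N κ).aestronglyMeasurable
    · filter_upwards [ae_restrict_mem measurableSet_Ici] with s hs
      have h1 := hT₁ s ((le_max_left T₁ T₂).trans hs)
      rw [Real.norm_of_nonneg (by positivity)]
      gcongr
      have h2 : 0 < 2 * κ * Real.exp (c s).re := by positivity
      nlinarith

lemma IsTobogganicContour.deriv_proj_zero_ne_zero {N : ℕ} {c : ℝ → ℂ}
    (h : IsTobogganicContour N c) : deriv (proj c) 0 ≠ 0 := by
  obtain ⟨ε, -, v, hv, hO⟩ := h.start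
  have h1 : HasDerivAt (fun s : ℝ => proj c s - (-Complex.I * ε + v * s)) 0 0 := by
    have h2 : (fun s : ℝ => proj c s - (-Complex.I * ε + v * s)) =O[𝓝 0]
        fun s : ℝ => ‖s - 0‖ ^ 2 := by
      refine hO.congr_right fun s => ?_
      rw [sub_zero, Real.norm_eq_abs, sq_abs]
    simpa using (h2.hasFDerivAt (𝕜 := ℝ) one_lt_two).hasDerivAt
  have h3 : HasDerivAt (fun s : ℝ => -Complex.I * ε + (v : ℂ) * s) v 0 := by
    simpa using ((Complex.ofRealCLM.hasDerivAt (x := (0 : ℝ))).const_mul (v : ℂ)).const_add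
      (-Complex.I * ε)
  have h4 := h1.add h3
  have h5 : HasDerivAt (proj c) v 0 := by
    refine (h4.congr_deriv (zero_add _)).congr_of_eventuallyEq (.of_forall fun s => ?_)
    simp only [Pi.add_apply, sub_add_cancel]
  rw [h5.deriv]
  exact_mod_cast hv.ne'

/-! ### Spirals -/

section Spiral

variable {N : ℕ} {ε : ℝ}

lemma I_mul_sub_eq (ε s : ℝ) : Complex.I * ((s : ℂ) - Complex.I * ε) = ε + s * Complex.I := by
  linear_combination (-(ε : ℂ)) * Complex.I_mul_I

lemma spiral_eq (N : ℕ) (ε s : ℝ) : spiral N ε s =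
    -(Real.pi / 2) * Complex.I + (2 * N + 1) * Complex.log (ε + s * Complex.I) := by
  rw [spiral, I_mul_sub_eq]

lemma add_mul_I_mem_slitPlane (hε : 0 < ε) (s : ℝ) :
    (ε : ℂ) + s * Complex.I ∈ Complex.slitPlane :=
  Or.inl (by simpa using hε)

lemma spiral_re (N : ℕ) (ε s : ℝ) :
    (spiral N ε s).re = (2 * N + 1) * Real.log ‖(ε : ℂ) + s * Complex.I‖ := by
  rw [spiral_eq, show (2 * (N : ℂ) + 1) = ((2 * N + 1 : ℝ) : ℂ) by push_cast; rfl,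
    Complex.add_re, Complex.re_ofReal_mul, Complex.log_re]
  simp

lemma spiral_im (N : ℕ) (ε s : ℝ) :
    (spiral N ε s).im = -(Real.pi / 2) + (2 * N + 1) * Complex.arg (ε + s * Complex.I) := by
  rw [spiral_eq, show (2 * (N : ℂ) + 1) = ((2 * N + 1 : ℝ) : ℂ) by push_cast; rfl,
    Complex.add_im, Complex.im_ofReal_mul, Complex.log_im]
  simp

lemma hasDerivAt_spiral (hε : 0 < ε) (s : ℝ) : HasDerivAt (spiral N ε)
    ((2 * N + 1) * (Complex.I / (ε + s * Complex.I))) s := by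
  have h1 : HasDerivAt (fun s : ℝ => (ε : ℂ) + s * Complex.I) Complex.I s := by
    simpa using ((Complex.ofRealCLM.hasDerivAt (x := s)).mul_const Complex.I).const_add (ε : ℂ)
  rw [funext (spiral_eq N ε)]
  exact ((h1.clog_real (add_mul_I_mem_slitPlane hε s)).const_mul _).const_add _

lemma contDiff_spiral (hε : 0 < ε) : ContDiff ℝ 1 (spiral N ε) := by
  rw [funext (spiral_eq N ε), contDiff_iff_contDiffAt]
  intro s
  have h1 : ContDiffAt ℝ 1 (fun s : ℝ => (ε : ℂ) + s * Complex.I) s :=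
    contDiffAt_const.add (Complex.ofRealCLM.contDiff.contDiffAt.mul contDiffAt_const)
  have h2 : ContDiffAt ℝ 1 Complex.log ((ε : ℂ) + s * Complex.I) :=
    (Complex.contDiffAt_log (add_mul_I_mem_slitPlane hε s)).restrict_scalars ℝ
  have h3 : ContDiffAt ℝ 1 (fun s : ℝ => Complex.log ((ε : ℂ) + s * Complex.I)) s :=
    ContDiffAt.comp (g := Complex.log) (f := fun s : ℝ => (ε : ℂ) + s * Complex.I) s h2 h1
  exact contDiffAt_const.add (contDiffAt_const.mul h3)

lemma spiral_neg (hε : 0 < ε) (s : ℝ) :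
    spiral N ε (-s) = (starRingEnd ℂ) (spiral N ε s) - Real.pi * Complex.I := by
  have h : (ε : ℂ) + ((-s : ℝ) : ℂ) * Complex.I = (starRingEnd ℂ) (ε + s * Complex.I) := by
    simp
  rw [spiral_eq, spiral_eq, h, Complex.log_conj _
    (Complex.slitPlane_arg_ne_pi (add_mul_I_mem_slitPlane hε s))]
  have h2 : (starRingEnd ℂ) 2 = 2 := Complex.conj_ofNat 2
  simp only [map_add, map_mul, map_neg, map_div₀, Complex.conj_I, Complex.conj_ofReal, h2, map_one,
    map_natCast]
  ring

lemma norm_deriv_proj_spiral (hε : 0 < ε) (s : ℝ) :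
    ‖deriv (proj (spiral N ε)) s‖ = (2 * N + 1) * ‖(ε : ℂ) + s * Complex.I‖ ^ (2 * N) := by
  have hz : 0 < ‖(ε : ℂ) + s * Complex.I‖ :=
    norm_pos_iff.mpr (Complex.slitPlane_ne_zero (add_mul_I_mem_slitPlane hε s))
  have hn : ‖(2 * (N : ℂ) + 1)‖ = 2 * N + 1 := by
    rw [show (2 * (N : ℂ) + 1) = ((2 * N + 1 : ℕ) : ℂ) by push_cast; rfl, Complex.norm_natCast]
    push_cast; rfl
  rw [(hasDerivAt_proj (contDiff_spiral hε) s).deriv, (hasDerivAt_spiral hε s).deriv, norm_mul,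
    norm_mul, norm_div, Complex.norm_exp, spiral_re, hn, Complex.norm_I,
    show (2 * (N : ℝ) + 1) * Real.log ‖(ε : ℂ) + s * Complex.I‖ =
      ((2 * N + 1 : ℕ) : ℝ) * Real.log ‖(ε : ℂ) + s * Complex.I‖ by push_cast; rfl,
    Real.exp_nat_mul, Real.exp_log hz]
  field_simp
  ring

lemma tendsto_norm_add_mul_I (ε : ℝ) :
    Tendsto (fun s : ℝ => ‖(ε : ℂ) + s * Complex.I‖) atTop atTop := by
  refine tendsto_atTop_mono' _ ?_ tendsto_id
  filter_upwards with s
  have := Complex.abs_im_le_norm ((ε : ℂ) + s * Complex.I)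
  simp at this
  exact (le_abs_self s).trans this

lemma tendsto_arg_add_mul_I (hε : 0 < ε) :
    Tendsto (fun s : ℝ => Complex.arg (ε + s * Complex.I)) atTop (𝓝 (Real.pi / 2)) := by
  have h1 : Tendsto (fun s : ℝ => Real.arccos (ε / ‖(ε : ℂ) + s * Complex.I‖)) atTop
      (𝓝 (Real.arccos 0)) :=
    (Real.continuous_arccos.tendsto 0).comp
      ((tendsto_norm_add_mul_I ε).const_div_atTop ε)
  rw [Real.arccos_zero] at h1
  refine (tendsto_congr' ?_).mp h1
  filter_upwards [eventually_ge_atTop 0] with s hs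
  have hz := Complex.slitPlane_ne_zero (add_mul_I_mem_slitPlane hε s)
  have h2 := Complex.cos_arg hz
  rw [show ((ε : ℂ) + s * Complex.I).re = ε by simp] at h2
  rw [← h2, Real.arccos_cos (Complex.arg_nonneg_iff.mpr (by simpa using hs)) (Complex.arg_le_pi _)]

/-- The spiral approaches the boundary `arg r = Nπ` of the Stokes wedge, but `Im (r e^{iNπ})`
still tends to `-∞`: it is at most `-ε |r|^{2N/(2N+1)}`. -/
lemma eventually_exp_mul_sin_spiral_le (hε : 0 < ε) : ∀ᶠ s in atTop,
    Real.exp (spiral N ε s).re * Real.sin ((spiral N ε s).im + N * Real.pi) ≤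
      -(ε * ‖(ε : ℂ) + s * Complex.I‖ ^ (2 * N)) := by
  have hφ : Tendsto (fun s : ℝ => (2 * N + 1) * (Real.pi / 2 - Complex.arg (ε + s * Complex.I)))
      atTop (𝓝 ((2 * N + 1) * (Real.pi / 2 - Real.pi / 2))) :=
    ((tendsto_arg_add_mul_I hε).const_sub _).const_mul _
  rw [sub_self, mul_zero] at hφ
  filter_upwards [hφ.eventually_lt_const (by positivity : 0 < Real.pi / 2)] with s hs
  have hslit := add_mul_I_mem_slitPlane hε s
  have hz := Complex.slitPlane_ne_zero hslit
  have hzn := norm_pos_iff.mpr hz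
  have hcos := Complex.cos_arg hz
  rw [show ((ε : ℂ) + s * Complex.I).re = ε by simp] at hcos
  have harg : Complex.arg (ε + s * Complex.I) ≤ Real.pi / 2 :=
    (abs_le.mp (Complex.abs_arg_le_pi_div_two_iff.mpr (by simpa using hε.le))).2
  set φ := Real.pi / 2 - Complex.arg (ε + s * Complex.I) with hφd
  have hφ0 : 0 ≤ φ := by rw [hφd]; linarith
  have hφle : φ ≤ (2 * N + 1) * φ := le_mul_of_one_le_left hφ0
    (by linarith [(N.cast_nonneg : (0:ℝ) ≤ N)])
  have hsinφ : Real.sin φ = ε / ‖(ε : ℂ) + s * Complex.I‖ := by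
    rw [hφd, Real.sin_pi_div_two_sub, hcos]
  have hmono : Real.sin φ ≤ Real.sin ((2 * N + 1) * φ) :=
    Real.sin_le_sin_of_le_of_le_pi_div_two (by linarith [Real.pi_pos]) hs.le hφle
  have him : Real.sin ((spiral N ε s).im + N * Real.pi) = -Real.sin ((2 * N + 1) * φ) := by
    rw [spiral_im, ← Real.sin_neg, show -(Real.pi / 2) + (2 * (N : ℝ) + 1) *
      Complex.arg (ε + s * Complex.I) + N * Real.pi =
        -((2 * N + 1) * φ) + N * (2 * Real.pi) by rw [hφd]; ring, Real.sin_add_nat_mul_two_pi]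
  have hre : Real.exp (spiral N ε s).re = ‖(ε : ℂ) + s * Complex.I‖ ^ (2 * N + 1) := by
    rw [spiral_re, show (2 * (N : ℝ) + 1) = ((2 * N + 1 : ℕ) : ℝ) by push_cast; rfl,
      Real.exp_nat_mul, Real.exp_log hzn]
  rw [him, hre, mul_neg, neg_le_neg_iff]
  calc ε * ‖(ε : ℂ) + s * Complex.I‖ ^ (2 * N)
      = ‖(ε : ℂ) + s * Complex.I‖ ^ (2 * N + 1) * Real.sin φ := by
        rw [hsinφ, pow_succ]; field_simp
    _ ≤ _ := by gcongr

lemma memLp_waveFunction_spiral {M : ℕ} (hN : N ≠ 0) {κ : ℝ} (hκ : 0 < κ) (hε : 0 < ε) :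
    MemLp (fun s => waveFunction N (M / (2 * N)) κ (spiral N ε s)) 2
      (arcLength (spiral N ε)) := by
  have hc := contDiff_spiral (N := N) hε
  have hN0 : (0 : ℝ) ≤ N := N.cast_nonneg
  refine memLp_waveFunction_of_symm hN hκ hc (spiral_neg hε) ?_ ?_
  · have h1 : Tendsto (fun s => (spiral N ε s).re) atTop atTop := by
      rw [funext (spiral_re N ε)]
      exact (Real.tendsto_log_atTop.comp (tendsto_norm_add_mul_I ε)).const_mul_atTop
        (by positivity)
    have h2 : Tendsto (fun s => (spiral N ε s).im) atTop
        (𝓝 (-(Real.pi / 2) + (2 * N + 1) * (Real.pi / 2))) := by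
      rw [funext (spiral_im N ε)]
      exact ((tendsto_arg_add_mul_I hε).const_mul _).const_add _
    filter_upwards [h1.eventually_ge_atTop (-Real.log κ),
      h2.eventually_const_lt (u := N * Real.pi - Real.pi) (by linarith [Real.pi_pos])] with s h3 h4
    refine ⟨h3, by linarith, ?_⟩
    have harg : Complex.arg (ε + s * Complex.I) ≤ Real.pi / 2 :=
      (abs_le.mp (Complex.abs_arg_le_pi_div_two_iff.mpr (by simpa using hε.le))).2
    rw [spiral_im]
    nlinarith
  · obtain ⟨T, hT⟩ := eventually_atTop.mp (eventually_exp_mul_sin_spiral_le (N := N) hε)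
    have hpow : IntegrableOn (fun s : ℝ => (2 * N + 1) / (2 * (κ * ε) ^ 2) * s ^ (-2 : ℝ))
        (Set.Ioi (max 1 T)) :=
      ((integrableOn_Ioi_rpow_of_lt (by norm_num) zero_lt_one).mono_set
        (Set.Ioi_subset_Ioi (le_max_left 1 T))).const_mul _
    refine ⟨_, Ioi_mem_atTop (max 1 T), hpow.mono' ?_ ?_⟩
    · exact (continuous_norm_deriv_proj_mul_exp_sin hc N κ).aestronglyMeasurable
    · filter_upwards [ae_restrict_mem measurableSet_Ioi] with s hs
      have hs1 : 1 < s := (le_max_left 1 T).trans_lt hs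
      have hsT : T ≤ s := (le_max_right 1 T).trans (le_of_lt hs)
      have hle := hT s hsT
      rw [Real.norm_of_nonneg (by positivity), norm_deriv_proj_spiral hε]
      have hsz : s ≤ ‖(ε : ℂ) + s * Complex.I‖ := by
        have := Complex.abs_im_le_norm ((ε : ℂ) + s * Complex.I)
        simp at this
        exact (le_abs_self s).trans this
      set y := ‖(ε : ℂ) + s * Complex.I‖ ^ (2 * N) with hy
      have hsy : s ^ 2 ≤ y := by
        calc s ^ 2 ≤ s ^ (2 * N) := pow_le_pow_right₀ hs1.le (by omega)
          _ ≤ y := by rw [hy]; gcongr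
      have hy0 : 0 < y := lt_of_lt_of_le (by positivity) hsy
      have h1 : Real.exp (2 * κ * Real.exp (spiral N ε s).re *
          Real.sin ((spiral N ε s).im + N * Real.pi)) ≤ Real.exp (-(2 * κ * ε * y)) := by
        apply Real.exp_le_exp.mpr
        have := mul_le_mul_of_nonneg_left hle (by positivity : 0 ≤ 2 * κ)
        linarith
      -- `e^{-x} ≤ 2 / x²`, and `y ≥ s²`.
      have h2 : Real.exp (-(2 * κ * ε * y)) ≤ 2 / (2 * κ * ε * y) ^ 2 := by
        have := Real.quadratic_le_exp_of_nonneg (by positivity : 0 ≤ 2 * κ * ε * y)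
        rw [Real.exp_neg, inv_le_comm₀ (Real.exp_pos _) (by positivity), inv_div]
        nlinarith [(by positivity : 0 ≤ 2 * κ * ε * y)]
      calc (2 * N + 1) * y * Real.exp (2 * κ * Real.exp (spiral N ε s).re *
            Real.sin ((spiral N ε s).im + N * Real.pi))
          ≤ (2 * N + 1) * y * (2 / (2 * κ * ε * y) ^ 2) := by
            gcongr; exact h1.trans h2
        _ = (2 * N + 1) / (2 * (κ * ε) ^ 2) * y⁻¹ := by field_simp
        _ ≤ (2 * N + 1) / (2 * (κ * ε) ^ 2) * (s ^ 2)⁻¹ := by gcongr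
        _ = _ := by rw [Real.rpow_neg (by linarith), Real.rpow_two]

lemma deriv_proj_spiral_ne_zero (hε : 0 < ε) (s : ℝ) : deriv (proj (spiral N ε)) s ≠ 0 := by
  have hz : 0 < ‖(ε : ℂ) + s * Complex.I‖ :=
    norm_pos_iff.mpr (Complex.slitPlane_ne_zero (add_mul_I_mem_slitPlane hε s))
  rw [← norm_pos_iff, norm_deriv_proj_spiral hε]
  positivity

end Spiral

lemma sin_pi_mul_ne_zero {N M : ℕ} (hN : 1 ≤ N) (hM : 1 ≤ M)
    (hMN : ∀ k : ℕ, 1 ≤ k → M ≠ 2 * k * N) : Real.sin (Real.pi * (M / (2 * N) : ℝ)) ≠ 0 := by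
  intro h
  obtain ⟨k, hk⟩ := Real.sin_eq_zero_iff.mp h
  have hN0 : (0 : ℝ) < N := by exact_mod_cast hN
  have h1 : (k : ℝ) = M / (2 * N) := by
    have := Real.pi_pos.ne'
    rw [mul_comm] at hk
    exact mul_left_cancel₀ this hk
  have h2 : (M : ℝ) = 2 * k * N := by rw [h1]; field_simp
  have h3 : (M : ℤ) = 2 * k * N := by exact_mod_cast h2
  have h4 : 0 < k := by
    by_contra hneg
    have : 2 * k * (N : ℤ) ≤ 0 :=
      mul_nonpos_of_nonpos_of_nonneg (by linarith) (by positivity)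
    omega
  obtain ⟨j, rfl⟩ := Int.eq_ofNat_of_zero_le h4.le
  exact hMN j (by exact_mod_cast h4) (by exact_mod_cast h3)

lemma isBoundState_waveFunction {N M : ℕ} (hN : 1 ≤ N) (hM : 1 ≤ M)
    (hMN : ∀ k : ℕ, 1 ≤ k → M ≠ 2 * k * N) {κ ℓ γ : ℝ} (hκ : 0 < κ)
    (hγ : ℓ * (ℓ + 1) + γ = (M / (2 * N) : ℝ) ^ 2 - 1 / 4) {c : ℝ → ℂ} (hc : ContDiff ℝ 1 c)
    (h0 : deriv (proj c) 0 ≠ 0)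
    (hL : MemLp (fun s => waveFunction N (M / (2 * N)) κ (c s)) 2 (arcLength c)) :
    IsBoundState c ℓ γ (κ ^ 2) (waveFunction N (M / (2 * N)) κ) := by
  have hS := solvesSchrodinger_waveFunction N (ν := M / (2 * N)) hκ hγ
  refine ⟨hS, hL, not_ae_eq_zero_arcLength hc h0 hS.1 ?_⟩
  obtain ⟨w, hw⟩ := exists_hankel2_ne_zero (sin_pi_mul_ne_zero hN hM hMN)
  refine ⟨w - (Real.log κ + N * Real.pi * Complex.I), ?_⟩
  rw [waveFunction, add_sub_cancel]
  exact mul_ne_zero (Complex.exp_ne_zero _) hw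

end Toboggan


theorem mainTheorem1 (D n : ℤ) (N M : ℕ) (hN : 1 ≤ N) (hM : 1 ≤ M)
    (hMN : ∀ k : ℕ, 1 ≤ k → M ≠ 2 * k * N)
    (ℓ γ : ℝ) (hℓ : ℓ = n + ((D : ℝ) - 3) / 2)
    (hγ : γ = ((M : ℝ) / (2 * N)) ^ 2 - (n + ((D : ℝ) - 2) / 2) ^ 2)
    (κ : ℝ) (hκ : 0 < κ) :
    (∀ c : ℝ → ℂ, Toboggan.IsTobogganicContour N c →
      Toboggan.IsBoundState c ℓ γ (κ ^ 2) (Toboggan.waveFunction N (M / (2 * N)) κ)) ∧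
    (∀ ε : ℝ, 0 < ε →
      Toboggan.IsBoundState (Toboggan.spiral N ε) ℓ γ (κ ^ 2)
        (Toboggan.waveFunction N (M / (2 * N)) κ)) := by
  have hN0 : N ≠ 0 := Nat.one_le_iff_ne_zero.mp hN
  have hν : ℓ * (ℓ + 1) + γ = (M / (2 * N) : ℝ) ^ 2 - 1 / 4 := by
    rw [hγ, hℓ]; ring
  exact ⟨fun c hc => Toboggan.isBoundState_waveFunction hN hM hMN hκ hν hc.contDiff
      hc.deriv_proj_zero_ne_zero (hc.memLp_waveFunction hN0 hκ),
    fun ε hε => Toboggan.isBoundState_waveFunction hN hM hMN hκ hν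
      (Toboggan.contDiff_spiral hε) (Toboggan.deriv_proj_spiral_ne_zero hε 0)
      (Toboggan.memLp_waveFunction_spiral hN0 hκ hε)⟩
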